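/- **Fermions.** Let $\psi^{(a)}_i,\psi^{\dagger(a)}_i$ ($a=1,2$, $i\in\mathbb Z$) and $\psi,\psi^\dagger$ be free complex fermions: $[\psi^{(a)}_i,\psi^{\dagger(b)}_j]_+=\delta_{ab}\delta_{ij}$, $[\psi,\psi^\dagger]_+=1$, all other anticommutators of generators being zero. They act on the Fock space with vacuum $|0\rangle$ and dual vacuum $\langle 0|$, $\langle 0|0\rangle=1$, where $$\psi^{(a)}_i|0\rangle=\psi^{\dagger(a)}_{-1-i}|0\rangle=0=\langle0|\psi^{\dagger(a)}_i=\langle 0|\psi^{(a)}_{-1-i}\ \ (i<0),\qquad \psi^\dagger|0\rangle=0=\langle0|\psi .$$ Put $$\varphi=\tfrac{1}{\sqrt2}(\psi+\psi^\dagger),\qquad \psi_j=\tfrac1{\sqrt2}\big(\psi^{(1)}_j+\psi^{\dagger(2)}_{-1-j}\big),\qquad \psi^\dagger_j=\tfrac1{\sqrt2}\big(\psi^{\dagger(1)}_j+\psi^{(2)}_{-1-j}\big),$$ so that $[\psi_i,\psi_j^\dagger]_+=\delta_{ij}$, $\varphi^2=\frac12$, and all other pairs of these anticommute. With ${:}xy{:}=xy-\langle0|xy|0\rangle$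 let $$\alpha^{(a)}_k=\sum_{l\in\mathbb Z}{:}\psi^{(a)}_l\psi^{\dagger(a)}_{l+k}{:},\qquad \beta_k=\sum_{l\in\mathbb Z}{:}\psi_l\psi^\dagger_{l+k}{:}\,.$$ For a family of fermions $x_i,x_i^\dagger$ let $\Psi^\dagger_n[x]=x^\dagger_0x_1^\dagger\cdots x^\dagger_{n-1}$ for $n\ge0$ and $\Psi^\dagger_n[x]=x_{-1}x_{-2}\cdots x_n$ for $n<0$. Let $\langle N|=\langle0|\Psi^\dagger_N[\psi]$ for $N$ even, $\langle N|=\sqrt2\,\langle0|\varphi\,\Psi_N^\dagger[\psi]$ for $N$ odd, and $\langle N,-N|=\langle0|\Psi^\dagger_N[\psi^{(1)}]\,\Psi^\dagger_{-N}[\psi^{(2)}]$. **Statement.** Let $A=(A_{ij})_{i,j\in\mathbb Z}$ be a complex matrix with $A_{ij}=-A_{ji}$, let $(a_i)_{i\in\mathbb Z}$ be complex numbers, and let $N\in\mathbb Z$. As formal power series in commuting indeterminates $t=(t_i)_{i\in\mathbb Z}$ define $$\tau^B_N(t)=\Big\langle N\Big|\,e^{\sum_{i}t_i\beta_i}\;e^{\frac12\sum_{i,j}A_{ij}\psi_i\psi_j+\sqrt2\sum_i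 a_i\psi_i\varphi}\Big|0\Big\rangle,$$ $$\tau^{\rm TL}_N(t,-t)=(-1)^{\frac{N(N+1)}2}\Big\langle N,-N\Big|\,e^{\sum_i t_i(\alpha^{(1)}_i-\alpha^{(2)}_i)}\;e^{\sum_{i,j}(A_{ij}-a_ia_j)\,\psi^{(1)}_i\psi^{\dagger(2)}_{-1-j}}\Big|0\Big\rangle .$$ (All sums run over $\mathbb Z$; the one-sided evolution in the times $t_1,t_2,\dots$ is obtained by setting $t_i=0$ for $i\le0$.) Both series are well defined: when the indices of $A$ and $a$ are restricted to a finite set $S\subset\mathbb Z$, the second exponent is nilpotent, and for each monomial in $t$ its coefficient is the same for all sufficiently large finite $S$; this common value is the coefficient of the series. Moreover $$\big(\tau^B_N(t)\big)^2=(-1)^N\,\tau^{\rm TL}_N(t,-t).$$ -/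

import Mathlib

noncomputable section

open scoped Nat

namespace Fermi

/-! ## The two-component fermionic Fock space -/

/-- Labels of the canonical pairs of fermions: `none` is the pair `ψ, ψ†`, and `some (a, i)` is the
pair `ψ^{(a)}_i, ψ^{†(a)}_i`.  The two components `a = 1, 2` are `(0 : Fin 2)` and
`(1 : Fin 2)`. -/
abbrev Label : Type := Option (Fin 2 × ℤ)

/-- The (right) Fock space, realised as the exterior algebra on one creation operator for every
canonical pair. -/
def Fock : Type := ExteriorAlgebra ℂ (Label →₀ ℂ)

instance : AddCommGroup Fock := inferInstanceAs (AddCommGroup (ExteriorAlgebra ℂ (Label →₀ ℂ)))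

instance : Module ℂ Fock := inferInstanceAs (Module ℂ (ExteriorAlgebra ℂ (Label →₀ ℂ)))

instance : Module ℚ Fock := Module.compHom Fock (algebraMap ℚ ℂ)

/-- Linear operators on the Fock space. -/
abbrev Op : Type := Module.End ℂ Fock

/-- The vacuum vector `|0⟩`. -/
def vac : Fock := (1 : ExteriorAlgebra ℂ (Label →₀ ℂ))

/-- The dual vacuum `⟨0|`: the coefficient of `|0⟩`. -/
def bra0 : Fock →ₗ[ℂ] ℂ :=
  (ExteriorAlgebra.algebraMapInv : ExteriorAlgebra ℂ (Label →₀ ℂ) →ₐ[ℂ] ℂ).toLinearMap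

/-- Creation operator (exterior multiplication by a basis vector). -/
def create (c : Label) : Op :=
  (LinearMap.mulLeft ℂ (ExteriorAlgebra.ι ℂ (Finsupp.single c (1 : ℂ))) :
    ExteriorAlgebra ℂ (Label →₀ ℂ) →ₗ[ℂ] ExteriorAlgebra ℂ (Label →₀ ℂ))

/-- Annihilation operator (contraction with a dual basis vector). -/
def annih (c : Label) : Op :=
  (CliffordAlgebra.contractLeft (Finsupp.lapply c : (Label →₀ ℂ) →ₗ[ℂ] ℂ) :
    ExteriorAlgebra ℂ (Label →₀ ℂ) →ₗ[ℂ] ExteriorAlgebra ℂ (Label →₀ ℂ))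

/-- `ψ^{(a)}_i`: it kills `|0⟩` for `i < 0`, and `⟨0|` for `i ≥ 0`. -/
def psiC (a : Fin 2) (i : ℤ) : Op := if 0 ≤ i then create (some (a, i)) else annih (some (a, i))

/-- `ψ^{†(a)}_i`: it kills `|0⟩` for `i ≥ 0`, and `⟨0|` for `i < 0`. -/
def psiDagC (a : Fin 2) (i : ℤ) : Op :=
  if 0 ≤ i then annih (some (a, i)) else create (some (a, i))

/-- `ψ`, with `⟨0|ψ = 0`. -/
def psi0 : Op := create none

/-- `ψ†`, with `ψ†|0⟩ = 0`. -/
def psiDag0 : Op := annih none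

/-! ## The neutral and charged fermions of type B -/

/-- `φ = (ψ + ψ†)/√2`. -/
def phi : Op := ((Real.sqrt 2 : ℝ) : ℂ)⁻¹ • (psi0 + psiDag0)

/-- `ψ_j = (ψ^{(1)}_j + ψ^{†(2)}_{-1-j})/√2`. -/
def psiB (j : ℤ) : Op := ((Real.sqrt 2 : ℝ) : ℂ)⁻¹ • (psiC 0 j + psiDagC 1 (-1 - j))

/-- `ψ†_j = (ψ^{†(1)}_j + ψ^{(2)}_{-1-j})/√2`. -/
def psiDagB (j : ℤ) : Op := ((Real.sqrt 2 : ℝ) : ℂ)⁻¹ • (psiDagC 0 j + psiC 1 (-1 - j))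

/-! ## Canonical anticommutation relations -/

theorem create_create (c d : Label) : create c * create d + create d * create c = 0 := by
  refine LinearMap.ext fun x : ExteriorAlgebra ℂ (Label →₀ ℂ) => ?_
  change ExteriorAlgebra.ι ℂ (Finsupp.single c (1 : ℂ)) *
      (ExteriorAlgebra.ι ℂ (Finsupp.single d (1 : ℂ)) * x) +
    ExteriorAlgebra.ι ℂ (Finsupp.single d (1 : ℂ)) *
      (ExteriorAlgebra.ι ℂ (Finsupp.single c (1 : ℂ)) * x) = 0
  rw [← mul_assoc, ← mul_assoc, ← add_mul, ExteriorAlgebra.ι_add_mul_swap, zero_mul]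

theorem annih_annih (c d : Label) : annih c * annih d + annih d * annih c = 0 := by
  refine LinearMap.ext fun x : ExteriorAlgebra ℂ (Label →₀ ℂ) => ?_
  change CliffordAlgebra.contractLeft (Finsupp.lapply c : (Label →₀ ℂ) →ₗ[ℂ] ℂ)
      (CliffordAlgebra.contractLeft (Finsupp.lapply d : (Label →₀ ℂ) →ₗ[ℂ] ℂ) x) +
    CliffordAlgebra.contractLeft (Finsupp.lapply d : (Label →₀ ℂ) →ₗ[ℂ] ℂ)
      (CliffordAlgebra.contractLeft (Finsupp.lapply c : (Label →₀ ℂ) →ₗ[ℂ] ℂ) x) = 0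
  rw [CliffordAlgebra.contractLeft_comm, neg_add_cancel]

theorem annih_create (c d : Label) :
    annih c * create d + create d * annih c = if c = d then 1 else 0 := by
  refine LinearMap.ext fun x : ExteriorAlgebra ℂ (Label →₀ ℂ) => ?_
  have h : CliffordAlgebra.contractLeft (Finsupp.lapply c : (Label →₀ ℂ) →ₗ[ℂ] ℂ)
      (ExteriorAlgebra.ι ℂ (Finsupp.single d (1 : ℂ)) * x) +
    ExteriorAlgebra.ι ℂ (Finsupp.single d (1 : ℂ)) *
      (CliffordAlgebra.contractLeft (Finsupp.lapply c : (Label →₀ ℂ) →ₗ[ℂ] ℂ) x) =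
      (Finsupp.single d (1 : ℂ)) c • x := by
    rw [ExteriorAlgebra.ι, CliffordAlgebra.contractLeft_ι_mul, sub_add_cancel]
    rfl
  refine (show _ = _ from h).trans ?_
  by_cases hcd : c = d
  · subst hcd
    rw [if_pos rfl, Finsupp.single_eq_same, one_smul]
    rfl
  · rw [if_neg hcd, Finsupp.single_eq_of_ne hcd, zero_smul]
    rfl

theorem create_annih (c d : Label) :
    create c * annih d + annih d * create c = if c = d then 1 else 0 := by
  rw [add_comm, annih_create]; simp [eq_comm]

theorem annih_vac (c : Label) : annih c vac = 0 :=
  CliffordAlgebra.contractLeft_one (Q := (0 : QuadraticForm ℂ (Label →₀ ℂ))) _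

theorem bra0_vac : bra0 vac = 1 :=
  map_one (ExteriorAlgebra.algebraMapInv : ExteriorAlgebra ℂ (Label →₀ ℂ) →ₐ[ℂ] ℂ)

theorem bra0_create (c : Label) (v : Fock) : bra0 (create c v) = 0 := by
  refine (map_mul (ExteriorAlgebra.algebraMapInv : ExteriorAlgebra ℂ (Label →₀ ℂ) →ₐ[ℂ] ℂ)
    (ExteriorAlgebra.ι ℂ (Finsupp.single c (1 : ℂ))) v).trans ?_
  rw [ExteriorAlgebra.algebraMapInv, ExteriorAlgebra.lift_ι_apply, LinearMap.zero_apply, zero_mul]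

/-- The Fock space is spanned by the vectors obtained from `|0⟩` by creation operators. -/
theorem fock_induction {P : Fock → Prop} (hvac : P vac) (hadd : ∀ v w, P v → P w → P (v + w))
    (hsmul : ∀ (r : ℂ) (v), P v → P (r • v)) (hcr : ∀ c v, P v → P (create c v)) (v : Fock) :
    P v := by
  refine CliffordAlgebra.left_induction (Q := (0 : QuadraticForm ℂ (Label →₀ ℂ))) (P := P)
    (fun r => ?_) hadd (fun x m hx => ?_) v
  · rw [Algebra.algebraMap_eq_smul_one]
    exact hsmul r _ hvac
  · induction m using Finsupp.induction_linear with
    | zero =>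
      rw [map_zero, zero_mul, ← zero_smul ℂ x]
      exact hsmul 0 x hx
    | add f g hf hg => rw [map_add, add_mul]; exact hadd _ _ hf hg
    | single c r =>
      have : Finsupp.single c r = r • Finsupp.single c (1 : ℂ) := by simp
      rw [this, map_smul, smul_mul_assoc]
      exact hsmul r _ (hcr c x hx)

theorem psiC_vac (a : Fin 2) {i : ℤ} (hi : i < 0) : psiC a i vac = 0 := by
  rw [psiC, if_neg (not_le.2 hi), annih_vac]

theorem psiDagC_vac (a : Fin 2) {i : ℤ} (hi : 0 ≤ i) : psiDagC a i vac = 0 := by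
  rw [psiDagC, if_pos hi, annih_vac]

theorem psiC_psiDagC (a b : Fin 2) (i j : ℤ) :
    psiC a i * psiDagC b j + psiDagC b j * psiC a i = if a = b ∧ i = j then 1 else 0 := by
  unfold psiC psiDagC
  split_ifs <;> simp_all [create_create, annih_annih, create_annih, annih_create]

theorem psiC_psiC (a b : Fin 2) (i j : ℤ) :
    psiC a i * psiC b j + psiC b j * psiC a i = 0 := by
  unfold psiC
  split_ifs with h1 h2 h2
  · exact create_create _ _
  · rw [create_annih, if_neg]
    simp only [Option.some.injEq, Prod.mk.injEq, not_and]; omega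
  · rw [annih_create, if_neg]
    simp only [Option.some.injEq, Prod.mk.injEq, not_and]; omega
  · exact annih_annih _ _

theorem psiDagC_psiDagC (a b : Fin 2) (i j : ℤ) :
    psiDagC a i * psiDagC b j + psiDagC b j * psiDagC a i = 0 := by
  unfold psiDagC
  split_ifs with h1 h2 h2
  · exact annih_annih _ _
  · rw [annih_create, if_neg]
    simp only [Option.some.injEq, Prod.mk.injEq, not_and]; omega
  · rw [create_annih, if_neg]
    simp only [Option.some.injEq, Prod.mk.injEq, not_and]; omega
  · exact create_create _ _

theorem inv_sqrt_two_mul_self : ((Real.sqrt 2 : ℝ) : ℂ)⁻¹ * ((Real.sqrt 2 : ℝ) : ℂ)⁻¹ = 2⁻¹ := by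
  rw [← mul_inv, ← Complex.ofReal_mul, Real.mul_self_sqrt (by norm_num)]; norm_num

theorem anticomm_smul_add (s : ℂ) (x y z w : Op) :
    (s • (x + y)) * (s • (z + w)) + (s • (z + w)) * (s • (x + y)) =
      (s * s) • ((x * z + z * x) + (x * w + w * x) + (y * z + z * y) + (y * w + w * y)) := by
  simp only [smul_mul_assoc, mul_smul_comm, smul_smul, ← smul_add]
  congr 1
  noncomm_ring

theorem psiB_psiB (i j : ℤ) : psiB i * psiB j + psiB j * psiB i = 0 := by
  rw [psiB, psiB, anticomm_smul_add, psiC_psiC, psiC_psiDagC, psiDagC_psiDagC,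
    add_comm (psiDagC 1 (-1 - i) * _), psiC_psiDagC]
  simp

theorem psiB_psiDagB (i j : ℤ) :
    psiB i * psiDagB j + psiDagB j * psiB i = if i = j then 1 else 0 := by
  rw [psiB, psiDagB, anticomm_smul_add, psiC_psiC, psiC_psiDagC, psiDagC_psiDagC,
    add_comm (psiDagC 1 (-1 - i) * _), psiC_psiDagC, inv_sqrt_two_mul_self]
  by_cases h : i = j
  · subst h
    simp only [and_self, if_true, add_zero]
    rw [← two_smul ℂ (1 : Op), smul_smul]; norm_num
  · have h' : ¬ j = i := fun e => h e.symm
    simp [h, h']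

theorem psi0_psiC (a : Fin 2) (i : ℤ) : psiC a i * psi0 + psi0 * psiC a i = 0 := by
  unfold psiC psi0; split_ifs <;> simp [create_create, annih_create]

theorem psi0_psiDagC (a : Fin 2) (i : ℤ) : psiDagC a i * psi0 + psi0 * psiDagC a i = 0 := by
  unfold psiDagC psi0; split_ifs <;> simp [create_create, annih_create]

theorem psiDag0_psiC (a : Fin 2) (i : ℤ) : psiC a i * psiDag0 + psiDag0 * psiC a i = 0 := by
  unfold psiC psiDag0; split_ifs <;> simp [annih_annih, create_annih]

theorem psiDag0_psiDagC (a : Fin 2) (i : ℤ) :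
    psiDagC a i * psiDag0 + psiDag0 * psiDagC a i = 0 := by
  unfold psiDagC psiDag0; split_ifs <;> simp [annih_annih, create_annih]

theorem psiB_phi (i : ℤ) : psiB i * phi + phi * psiB i = 0 := by
  rw [psiB, phi, anticomm_smul_add, psi0_psiC, psi0_psiDagC, psiDag0_psiC, psiDag0_psiDagC]
  simp

theorem phi_phi : phi * phi = (2⁻¹ : ℂ) • (1 : Op) := by
  have h1 := create_create none none
  have h2 := annih_annih none none
  have h3 := create_annih none none
  rw [← two_smul ℂ, smul_eq_zero_iff_right two_ne_zero] at h1 h2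
  rw [phi, psi0, psiDag0, smul_mul_assoc, mul_smul_comm, smul_smul, inv_sqrt_two_mul_self,
    add_mul, mul_add, mul_add, h1, h2, zero_add, add_zero, h3, if_pos rfl]

/-! ## Oscillators -/

/-- The operator `v ↦ ∑_l f_l v`, for a family of operators of which only finitely many do not
kill `v`, for each `v`. -/
def locFinSum (f : ℤ → Op) (hf : ∀ v, (Function.support fun l => f l v).Finite) : Op where
  toFun v := ∑ᶠ l, f l v
  map_add' v w := by
    simp only [map_add]
    exact finsum_add_distrib (hf v) (hf w)
  map_smul' r v := by
    simp only [map_smul, RingHom.id_apply]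
    exact (smul_finsum' r (hf v)).symm

/-- The normally ordered product `:xy: = xy - ⟨0|xy|0⟩` of two fermions. -/
def normalProd (x y : Op) : Op := x * y - bra0 (x (y vac)) • (1 : Op)

theorem locFin_normalProd (X Y : ℤ → Op) (k : ℤ)
    (hX : ∀ l < 0, X l vac = 0) (hY : ∀ l, 0 ≤ l → Y l vac = 0)
    (hXY : ∀ l m, X l * Y m + Y m * X l = if l = m then 1 else 0)
    (hXc : ∀ c, {l | X l * create c + create c * X l ≠ 0}.Finite)
    (hYc : ∀ c, {l | Y l * create c + create c * Y l ≠ 0}.Finite) (v : Fock) :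
    (Function.support fun l => normalProd (X l) (Y (l + k)) v).Finite := by
  have hadd : ∀ v w : Fock, (Function.support fun l => normalProd (X l) (Y (l + k)) v).Finite →
      (Function.support fun l => normalProd (X l) (Y (l + k)) w).Finite →
      (Function.support fun l => normalProd (X l) (Y (l + k)) (v + w)).Finite := by
    intro v w hv hw
    refine (hv.union hw).subset fun l hl => ?_
    by_contra hc
    simp only [Set.mem_union, Function.mem_support, not_or, not_not] at hc
    exact hl (by simp only [map_add, hc.1, hc.2, add_zero])
  have hsmul : ∀ (r : ℂ) (v : Fock),
      (Function.support fun l => normalProd (X l) (Y (l + k)) v).Finite →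
      (Function.support fun l => normalProd (X l) (Y (l + k)) (r • v)).Finite := by
    intro r v hv
    refine hv.subset fun l hl hc => hl ?_
    have hc' : normalProd (X l) (Y (l + k)) v = 0 := hc
    simp only [map_smul, hc', smul_zero]
  have hvac : (Function.support fun l => normalProd (X l) (Y (l + k)) vac).Finite := by
    refine (Set.finite_Ico (0 : ℤ) (-k)).subset fun l hl => ?_
    by_contra hc
    apply hl
    simp only [normalProd, LinearMap.sub_apply, Module.End.mul_apply, LinearMap.smul_apply,
      Module.End.one_apply]
    by_cases h : 0 ≤ l + k
    · simp [hY _ h]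
    · have hl0 : l < 0 := by
        by_contra h0
        exact hc (Set.mem_Ico.2 ⟨by omega, by omega⟩)
      have e : X l (Y (l + k) vac) = (if l = l + k then (1 : Op) else 0) vac := by
        rw [← hXY]
        simp [hX l hl0]
      rw [e]
      split_ifs
      · simp [bra0_vac]
      · simp
  have hcr : ∀ (c : Label) (v : Fock),
      (Function.support fun l => normalProd (X l) (Y (l + k)) v).Finite →
      (Function.support fun l => normalProd (X l) (Y (l + k)) (create c v)).Finite := by
    intro c v hv
    have hY' : {l | Y (l + k) * create c + create c * Y (l + k) ≠ 0}.Finite :=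
      (hYc c).preimage (f := fun l : ℤ => l + k) ((add_left_injective k).injOn)
    refine ((hv.union (hXc c)).union hY').subset fun l hl => ?_
    by_contra hc
    simp only [Set.mem_union, Function.mem_support, Set.mem_ofPred_eq, not_or, not_not] at hc
    obtain ⟨⟨h1, h2⟩, h3⟩ := hc
    apply hl
    have h2' := eq_neg_of_add_eq_zero_left h2
    have h3' := eq_neg_of_add_eq_zero_left h3
    have comm : normalProd (X l) (Y (l + k)) * create c
        = create c * normalProd (X l) (Y (l + k)) := by
      rw [normalProd, sub_mul, mul_sub, mul_assoc, h3', mul_neg, ← mul_assoc, h2']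
      simp [mul_assoc]
    have := congrArg (fun T : Op => T v) comm
    simp only [Module.End.mul_apply] at this
    simp only [this, h1, map_zero]
  exact fock_induction hvac hadd hsmul hcr v

theorem psiC_create_finite (a : Fin 2) (c : Label) :
    {l | psiC a l * create c + create c * psiC a l ≠ 0}.Finite := by
  refine ((Set.finite_singleton c).preimage
    (f := fun l : ℤ => (some (a, l) : Label)) (fun x _ y _ h => by simpa using h)).subset ?_
  intro l hl
  by_contra hc
  apply hl
  unfold psiC
  split_ifs
  · exact create_create _ _
  · rw [annih_create]
    exact if_neg hc

theorem psiDagC_create_finite (a : Fin 2) (c : Label) :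
    {l | psiDagC a l * create c + create c * psiDagC a l ≠ 0}.Finite := by
  refine ((Set.finite_singleton c).preimage
    (f := fun l : ℤ => (some (a, l) : Label)) (fun x _ y _ h => by simpa using h)).subset ?_
  intro l hl
  by_contra hc
  apply hl
  unfold psiDagC
  split_ifs
  · rw [annih_create]
    exact if_neg hc
  · exact create_create _ _

theorem smul_add_create_finite (s : ℂ) (X Y : ℤ → Op) (c : Label)
    (hX : {l | X l * create c + create c * X l ≠ 0}.Finite)
    (hY : {l | Y l * create c + create c * Y l ≠ 0}.Finite) :
    {l | (s • (X l + Y (-1 - l))) * create c + create c * (s • (X l + Y (-1 - l))) ≠ 0}.Finite := by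
  refine (hX.union (hY.preimage (f := fun l : ℤ => -1 - l) (fun x _ y _ h => by
    simpa using h))).subset fun l hl => ?_
  by_contra hc
  simp only [Set.mem_union, Set.mem_preimage, Set.mem_ofPred_eq, not_or, not_not] at hc
  apply hl
  have : (s • (X l + Y (-1 - l))) * create c + create c * (s • (X l + Y (-1 - l)))
      = s • ((X l * create c + create c * X l)
        + (Y (-1 - l) * create c + create c * Y (-1 - l))) := by
    simp only [smul_mul_assoc, mul_smul_comm, ← smul_add]
    congr 1
    noncomm_ring
  rw [this, hc.1, hc.2, add_zero, smul_zero]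

theorem psiB_vac {l : ℤ} (hl : l < 0) : psiB l vac = 0 := by
  simp [psiB, psiC_vac 0 hl, psiDagC_vac 1 (show 0 ≤ -1 - l by omega)]

theorem psiDagB_vac {l : ℤ} (hl : 0 ≤ l) : psiDagB l vac = 0 := by
  simp [psiDagB, psiDagC_vac 0 hl, psiC_vac 1 (show -1 - l < 0 by omega)]

/-- `α^{(a)}_k = ∑_{l ∈ ℤ} :ψ^{(a)}_l ψ^{†(a)}_{l+k}:`. -/
def alpha (a : Fin 2) (k : ℤ) : Op :=
  locFinSum (fun l => normalProd (psiC a l) (psiDagC a (l + k)))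
    (locFin_normalProd _ _ k (fun _ hl => psiC_vac a hl) (fun _ hl => psiDagC_vac a hl)
      (fun l m => by rw [psiC_psiDagC]; simp) (psiC_create_finite a) (psiDagC_create_finite a))

/-- `β_k = ∑_{l ∈ ℤ} :ψ_l ψ†_{l+k}:`. -/
def beta (k : ℤ) : Op :=
  locFinSum (fun l => normalProd (psiB l) (psiDagB (l + k)))
    (locFin_normalProd _ _ k (fun _ hl => psiB_vac hl) (fun _ hl => psiDagB_vac hl) psiB_psiDagB
      (fun c => smul_add_create_finite _ _ _ c (psiC_create_finite 0 c) (psiDagC_create_finite 1 c))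
      (fun c => smul_add_create_finite _ _ _ c (psiDagC_create_finite 0 c)
        (psiC_create_finite 1 c)))

/-! ## Charged dual vacua -/

/-- For a family of fermions `x_i, x†_i`: the product `x†_0 ⋯ x†_{n-1}` if `n ≥ 0`, and
`x_{-1} x_{-2} ⋯ x_n` if `n < 0`. -/
def PsiDag (x xd : ℤ → Op) (n : ℤ) : Op :=
  if 0 ≤ n then ((List.range n.toNat).map fun k => xd (k : ℤ)).prod
  else ((List.range (-n).toNat).map fun k => x (-1 - (k : ℤ))).prod

/-- The dual vector `⟨n|`: it is `⟨0|Ψ†_n` for `n` even and `√2 ⟨0|φ Ψ†_n` for `n` odd. -/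
def braB (n : ℤ) : Fock →ₗ[ℂ] ℂ :=
  if Even n then bra0 ∘ₗ PsiDag psiB psiDagB n
  else ((Real.sqrt 2 : ℝ) : ℂ) • (bra0 ∘ₗ (phi * PsiDag psiB psiDagB n))

/-- The dual vector `⟨n, m| = ⟨0|Ψ^{†(1)}_n Ψ^{†(2)}_m`. -/
def braC (n m : ℤ) : Fock →ₗ[ℂ] ℂ :=
  bra0 ∘ₗ (PsiDag (psiC 0) (psiDagC 0) n * PsiDag (psiC 1) (psiDagC 1) m)

/-! ## Formal time evolution -/

/-- The operator-valued formal series `∑_{i ∈ ℤ} t_i B_i` in commuting indeterminates `t_i`. -/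
def timeSeries (B : ℤ → Op) : MvPowerSeries ℤ Op :=
  fun d => ∑ i ∈ d.support, if d = Finsupp.single i 1 then B i else 0

/-- `e^T = ∑_k T^k / k!` for a formal series `T` without constant term; then `T^k` has no terms of
degree less than `k`. -/
def seriesExp (T : MvPowerSeries ℤ Op) : MvPowerSeries ℤ Op :=
  fun d => ∑ k ∈ Finset.range (d.degree + 1), ((k ! : ℂ)⁻¹) • MvPowerSeries.coeff d (T ^ k)

/-- The scalar series `⟨u| e^{∑_i t_i B_i} |v⟩`. -/
def evolve (u : Fock →ₗ[ℂ] ℂ) (B : ℤ → Op) (v : Fock) : MvPowerSeries ℤ ℂ :=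
  fun d => u (MvPowerSeries.coeff d (seriesExp (timeSeries B)) v)

/-! ## The quadratic exponents -/

/-- `½ ∑_{i,j} A_{ij} ψ_i ψ_j + √2 ∑_i a_i ψ_i φ`, the indices running over the finite set `S`. -/
def quadB (A : ℤ → ℤ → ℂ) (a : ℤ → ℂ) (S : Finset ℤ) : Op :=
  (2⁻¹ : ℂ) • (∑ i ∈ S, ∑ j ∈ S, A i j • (psiB i * psiB j))
    + ((Real.sqrt 2 : ℝ) : ℂ) • ∑ i ∈ S, a i • (psiB i * phi)

/-- `∑_{i,j} M_{ij} ψ^{(1)}_i ψ^{†(2)}_{-1-j}`, the indices running over the finite set `S`. -/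
def quadTL (M : ℤ → ℤ → ℂ) (S : Finset ℤ) : Op :=
  ∑ i ∈ S, ∑ j ∈ S, M i j • (psiC 0 i * psiDagC 1 (-1 - j))

theorem mul_pair_comm {x y z : Op} (hxz : x * z = -(z * x)) (hyz : y * z = -(z * y)) :
    Commute (x * y) z := by
  change x * y * z = z * (x * y)
  rw [mul_assoc, hyz, mul_neg, ← mul_assoc, hxz, neg_mul, neg_neg, mul_assoc]

theorem sq_pair {x y : Op} (hx : x * x = 0) (hxy : y * x = -(x * y)) : (x * y) ^ 2 = 0 := by
  rw [pow_two, mul_assoc, ← mul_assoc y, hxy, neg_mul, mul_neg, ← mul_assoc, ← mul_assoc, hx]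
  simp

theorem sq_zero_of_anticomm {x : Op} (h : x * x + x * x = 0) : x * x = 0 := by
  rwa [← two_smul ℂ, smul_eq_zero_iff_right two_ne_zero] at h

theorem isNilpotent_quadTL (M : ℤ → ℤ → ℂ) (S : Finset ℤ) : IsNilpotent (quadTL M S) := by
  have hcc := fun i j => eq_neg_of_add_eq_zero_left (psiC_psiC 0 0 i j)
  have hdd := fun i j => eq_neg_of_add_eq_zero_left (psiDagC_psiDagC 1 1 i j)
  have hcd : ∀ i j, psiC 0 i * psiDagC 1 j = -(psiDagC 1 j * psiC 0 i) := fun i j =>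
    eq_neg_of_add_eq_zero_left (by rw [psiC_psiDagC]; simp)
  have hdc : ∀ i j, psiDagC 1 j * psiC 0 i = -(psiC 0 i * psiDagC 1 j) := fun i j => by
    rw [hcd, neg_neg]
  have hcomm : ∀ i j k l, Commute (psiC 0 i * psiDagC 1 j) (psiC 0 k * psiDagC 1 l) :=
    fun i j k l => (mul_pair_comm (hcc _ _) (hdc _ _)).mul_right (mul_pair_comm (hcd _ _) (hdd _ _))
  unfold quadTL
  rw [← Finset.sum_product']
  refine Commute.isNilpotent_sum (fun p _ => ?_) fun p q _ _ => ?_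
  · exact IsNilpotent.smul ⟨2, sq_pair (sq_zero_of_anticomm (psiC_psiC 0 0 _ _)) (hdc _ _)⟩ _
  · exact ((hcomm _ _ _ _).smul_left _).smul_right _

theorem isNilpotent_quadB (A : ℤ → ℤ → ℂ) (a : ℤ → ℂ) (S : Finset ℤ) :
    IsNilpotent (quadB A a S) := by
  have hbb := fun i j => eq_neg_of_add_eq_zero_left (psiB_psiB i j)
  have hbp := fun i => eq_neg_of_add_eq_zero_left (psiB_phi i)
  have hcomm : ∀ i j k, Commute (psiB i * psiB j) (psiB k) :=
    fun i j k => mul_pair_comm (hbb _ _) (hbb _ _)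
  have hcomm' : ∀ i j, Commute (psiB i * psiB j) phi :=
    fun i j => mul_pair_comm (hbp _) (hbp _)
  have h1 : IsNilpotent (∑ i ∈ S, ∑ j ∈ S, A i j • (psiB i * psiB j)) := by
    rw [← Finset.sum_product']
    refine Commute.isNilpotent_sum (fun p _ => ?_) fun p q _ _ => ?_
    · exact IsNilpotent.smul ⟨2, sq_pair (sq_zero_of_anticomm (psiB_psiB _ _)) (hbb _ _)⟩ _
    · exact (((hcomm _ _ _).mul_right (hcomm _ _ _)).smul_left _).smul_right _
  have h2 : IsNilpotent (∑ i ∈ S, a i • (psiB i * phi)) := by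
    set X : Op := ∑ i ∈ S, a i • psiB i with hX
    have e : ∑ i ∈ S, a i • (psiB i * phi) = X * phi := by
      rw [hX, Finset.sum_mul]; simp only [smul_mul_assoc]
    have hpX : phi * X = -(X * phi) := by
      rw [hX, Finset.sum_mul, Finset.mul_sum, ← Finset.sum_neg_distrib]
      refine Finset.sum_congr rfl fun i _ => ?_
      rw [mul_smul_comm, smul_mul_assoc, hbp, smul_neg, neg_neg]
    have hXX : X * X = 0 := by
      refine sq_zero_of_anticomm ?_
      have : X * X = -(X * X) := by
        conv_lhs => rw [hX, Finset.sum_mul_sum]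
        conv_rhs => rw [hX, Finset.sum_mul_sum, Finset.sum_comm, ← Finset.sum_neg_distrib]
        refine Finset.sum_congr rfl fun i _ => ?_
        rw [← Finset.sum_neg_distrib]
        refine Finset.sum_congr rfl fun j _ => ?_
        simp only [smul_mul_assoc, mul_smul_comm, smul_smul]
        rw [hbb i j, smul_neg, mul_comm]
      exact add_eq_zero_iff_eq_neg.2 this
    exact e ▸ ⟨2, sq_pair hXX hpX⟩
  refine Commute.isNilpotent_add ?_ (h1.smul _) (h2.smul _)
  refine (Commute.smul_left ?_ _).smul_right _
  refine Commute.sum_left _ _ _ fun i _ => Commute.sum_left _ _ _ fun j _ =>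
    Commute.sum_right _ _ _ fun k _ => ?_
  exact (((hcomm _ _ _).mul_right (hcomm' _ _)).smul_left _).smul_right _

/-! ## Tau functions -/

/-- `⟨N| e^{∑_i t_i β_i} e^{½ ∑ A_{ij} ψ_i ψ_j + √2 ∑ a_i ψ_i φ} |0⟩`, with the indices of `A` and
`a` running over the finite set `S`. -/
def tauBTrunc (A : ℤ → ℤ → ℂ) (a : ℤ → ℂ) (N : ℤ) (S : Finset ℤ) : MvPowerSeries ℤ ℂ :=
  evolve (braB N) beta (IsNilpotent.exp (quadB A a S) vac)

/-- The B-type tau function `τ^B_N(t)`: the coefficientwise limit, as `S` increases to `ℤ`, of the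
truncations (each coefficient becomes constant). -/
def tauB (A : ℤ → ℤ → ℂ) (a : ℤ → ℂ) (N : ℤ) : MvPowerSeries ℤ ℂ :=
  fun d => Filter.limUnder Filter.atTop fun S : Finset ℤ => MvPowerSeries.coeff d (tauBTrunc A a N S)

/-- `(-1)^{N(N+1)/2} ⟨N,-N| e^{∑_i t_i (α^{(1)}_i - α^{(2)}_i)}
e^{∑ M_{ij} ψ^{(1)}_i ψ^{†(2)}_{-1-j}} |0⟩`, with the indices of `M` running over the finite
set `S`. -/
def tauTLTrunc (M : ℤ → ℤ → ℂ) (N : ℤ) (S : Finset ℤ) : MvPowerSeries ℤ ℂ :=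
  ((-1 : ℂ) ^ (N * (N + 1) / 2)) •
    evolve (braC N (-N)) (fun i => alpha 0 i - alpha 1 i) (IsNilpotent.exp (quadTL M S) vac)

/-- The Toda lattice tau function `τ^{TL}_N(t, -t)`: the coefficientwise limit, as `S` increases to
`ℤ`, of the truncations (each coefficient becomes constant). -/
def tauTL (M : ℤ → ℤ → ℂ) (N : ℤ) : MvPowerSeries ℤ ℂ :=
  fun d => Filter.limUnder Filter.atTop fun S : Finset ℤ => MvPowerSeries.coeff d (tauTLTrunc M N S)

end Fermi

end

noncomputable section

open scoped Nat

namespace Fermi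

/-! The Toda lattice expectation value splits into two copies of the B-type one after a change of
basis. Besides ψ_j there is a second family ψ'_j, with ψ^{(1)}_j = (ψ_j + iψ'_j)/√2 and
ψ^{†(2)}_{-1-j} = (ψ_j - iψ'_j)/√2. Both families obey the same anticommutation relations and vacuum
conditions, and they anticommute with each other. In these terms α^{(1)}_k - α^{(2)}_k = β_k + β'_k
(`alpha_sub_alpha`), and the product defining ⟨N,-N| becomes i^N Ψ†_N[ψ] Ψ†_N[ψ']
(`PsiDag_mul_PsiDag`). In the exponent the antisymmetric matrix A gives one quadratic form in each
family, while a_i a_j gives only the coupling iXX', where X = ∑ a_i ψ_i and X' = ∑ a_i ψ'_i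
(`quadTL_eq`).

An expectation value of a word in one family depends only on the relations and the vacuum
conditions. Replacing |0⟩ by any other vector v killed by the annihilators multiplies it by ⟨0|v⟩
(`bra0_mul_of_mem_corrAlgebra`). Hence the words in ψ and ψ' factor, and up to a prefactor the Toda
side is F² + i(-1)^N G², where F is the expectation value of Ψ†_N e^{∑ t β} e^{½ ∑ A ψψ} and G is
the same with X inserted on the right. By parity G = 0 for even N and F = 0 for odd N. Eliminating φ
shows that τ^B_N is F or G respectively (`coeff_tauBTrunc`), and the signs match (`sign_of_even`,
`sign_of_odd`). This proves the identity for every finite truncation (`tauBTrunc_sq`).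

A coefficient of the truncated τ^B_N does not change when an index i < 0 is added, because ψ_i kills
|0⟩, nor when a large i is added, because the dual vector then kills ψ_i (`exists_killsFrom`).
Stabilization of the Toda side follows from the truncated identity. -/

/-! ## Families of charged fermions -/

/-- The families `X_i = x_i` and `Y_i = x†_i` satisfy the canonical anticommutation relations and
have the same vacua as `ψ^{(a)}_i, ψ^{†(a)}_i`. -/
structure IsCharged (X Y : ℤ → Op) : Prop where
  XX : ∀ i j, X i * X j + X j * X i = 0
  YY : ∀ i j, Y i * Y j + Y j * Y i = 0
  XY : ∀ i j, X i * Y j + Y j * X i = if i = j then 1 else 0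
  X_vac : ∀ l < 0, X l vac = 0
  Y_vac : ∀ l, 0 ≤ l → Y l vac = 0
  bra_X : ∀ l, 0 ≤ l → ∀ v, bra0 (X l v) = 0
  bra_Y : ∀ l < 0, ∀ v, bra0 (Y l v) = 0
  X_create : ∀ c, {l | X l * create c + create c * X l ≠ 0}.Finite
  Y_create : ∀ c, {l | Y l * create c + create c * Y l ≠ 0}.Finite

/-- The current `∑_l :x_l x†_{l+k}:` of a family of charged fermions. -/
def current {X Y : ℤ → Op} (h : IsCharged X Y) (k : ℤ) : Op :=
  locFinSum (fun l => normalProd (X l) (Y (l + k)))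
    (locFin_normalProd _ _ k h.X_vac h.Y_vac h.XY h.X_create h.Y_create)

theorem locFinSum_apply (f : ℤ → Op) (hf) (v : Fock) : locFinSum f hf v = ∑ᶠ l, f l v := rfl

theorem locFinSum_apply_eq_sum (f : ℤ → Op) (hf) (v : Fock) (s : Finset ℤ)
    (hs : (Function.support fun l => f l v) ⊆ s) : locFinSum f hf v = ∑ l ∈ s, f l v :=
  finsum_eq_sum_of_support_subset _ hs

theorem Commute.locFinSum_right {T : Op} (f : ℤ → Op) (hf) (h : ∀ l, Commute T (f l)) :
    Commute T (locFinSum f hf) := by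
  refine LinearMap.ext fun v => ?_
  have e : ∀ l, T (f l v) = f l (T v) := fun l => congrArg (fun W : Op => W v) (h l)
  simp only [Module.End.mul_apply, locFinSum_apply]
  rw [← finsum_congr e]
  exact (T : Fock →+ Fock).map_finsum (hf v)

theorem Commute.normalProd_right {T x y : Op} (h : Commute T (x * y)) :
    Commute T (normalProd x y) :=
  h.sub_right ((Commute.one_right T).smul_right _)

/-- Taking the vacuum expectation of the anticommutator shows that the two subtracted constants add
up to `c`. -/
theorem normalProd_add_swap {x y : Op} {c : ℂ} (h : x * y + y * x = c • (1 : Op)) :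
    normalProd x y = -normalProd y x := by
  have e : bra0 (x (y vac)) + bra0 (y (x vac)) = c := by
    have := congrArg (fun W : Op => bra0 (W vac)) h
    simpa [bra0_vac] using this
  rw [eq_neg_iff_add_eq_zero, normalProd, normalProd, sub_add_sub_comm, h, ← add_smul, e, sub_self]

theorem normalProd_add_left (x x' y : Op) :
    normalProd (x + x') y = normalProd x y + normalProd x' y := by
  simp only [normalProd, add_mul, LinearMap.add_apply, map_add, add_smul]
  abel

theorem normalProd_add_right (x y y' : Op) :
    normalProd x (y + y') = normalProd x y + normalProd x y' := by
  simp only [normalProd, mul_add, LinearMap.add_apply, map_add, add_smul]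
  abel

theorem normalProd_smul_left (r : ℂ) (x y : Op) :
    normalProd (r • x) y = r • normalProd x y := by
  simp [normalProd, smul_sub, mul_smul]

theorem normalProd_smul_right (r : ℂ) (x y : Op) :
    normalProd x (r • y) = r • normalProd x y := by
  simp [normalProd, smul_sub, mul_smul]

theorem normalProd_smul_smul {r s : ℂ} (h : r * s = 1) (x y : Op) :
    normalProd (r • x) (s • y) = normalProd x y := by
  rw [normalProd_smul_left, normalProd_smul_right, smul_smul, h, one_smul]

namespace IsCharged

variable {X Y : ℤ → Op}

/-- The value is the same for all charged families, so normal ordering subtracts the same constants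
in each of them. -/
theorem vev (h : IsCharged X Y) (l m : ℤ) :
    bra0 (X l (Y m vac)) = if l = m ∧ l < 0 then 1 else 0 := by
  by_cases hl : 0 ≤ l
  · rw [h.bra_X l hl, if_neg (by omega)]
  · by_cases hm : 0 ≤ m
    · rw [h.Y_vac m hm, map_zero, map_zero, if_neg (by omega)]
    · have e := congrArg (fun W : Op => bra0 (W vac)) (h.XY l m)
      simp only [LinearMap.add_apply, Module.End.mul_apply, h.X_vac l (not_le.1 hl),
        map_zero, add_zero] at e
      rw [e]
      by_cases hlm : l = m
      · simp [hlm, bra0_vac, not_le.1 hm]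
      · simp [hlm]

/-- Comparing a family with its negative yields the parity selection rules below. -/
theorem neg (h : IsCharged X Y) : IsCharged (fun i => -X i) (fun i => -Y i) where
  XX i j := by simpa using h.XX i j
  YY i j := by simpa using h.YY i j
  XY i j := by simpa using h.XY i j
  X_vac l hl := by simp [h.X_vac l hl]
  Y_vac l hl := by simp [h.Y_vac l hl]
  bra_X l hl v := by simp [h.bra_X l hl]
  bra_Y l hl v := by simp [h.bra_Y l hl]
  X_create c := by
    refine (h.X_create c).subset fun l hl => ?_
    simpa only [Set.mem_ofPred_eq, neg_mul, mul_neg, ← neg_add, ne_eq, neg_eq_zero] using hl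
  Y_create c := by
    refine (h.Y_create c).subset fun l hl => ?_
    simpa only [Set.mem_ofPred_eq, neg_mul, mul_neg, ← neg_add, ne_eq, neg_eq_zero] using hl

theorem current_neg (h : IsCharged X Y) : current h.neg = current h := by
  funext k
  refine LinearMap.ext fun v => finsum_congr fun l => ?_
  have := normalProd_smul_smul (r := -1) (s := -1) (by norm_num) (X l) (Y (l + k))
  simp only [neg_smul, one_smul] at this
  exact congrArg (fun W : Op => W v) this

/-- Linear combinations of two mutually anticommuting families of charged fermions. -/
theorem smul_add {X₁ Y₁ X₂ Y₂ : ℤ → Op} (h₁ : IsCharged X₁ Y₁) (h₂ : IsCharged X₂ Y₂)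
    (hXX : ∀ i j, X₁ i * X₂ j + X₂ j * X₁ i = 0) (hYY : ∀ i j, Y₁ i * Y₂ j + Y₂ j * Y₁ i = 0)
    (hXY : ∀ i j, X₁ i * Y₂ j + Y₂ j * X₁ i = 0) (hYX : ∀ i j, Y₁ i * X₂ j + X₂ j * Y₁ i = 0)
    {p q r s : ℂ} (hpr : p * r + q * s = 1) :
    IsCharged (fun i => p • X₁ i + q • X₂ i) (fun i => r • Y₁ i + s • Y₂ i) where
  XX i j := by
    have e : (p • X₁ i + q • X₂ i) * (p • X₁ j + q • X₂ j) +
        (p • X₁ j + q • X₂ j) * (p • X₁ i + q • X₂ i) =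
        (p * p) • (X₁ i * X₁ j + X₁ j * X₁ i) + (p * q) • (X₁ i * X₂ j + X₂ j * X₁ i) +
        (p * q) • (X₁ j * X₂ i + X₂ i * X₁ j) + (q * q) • (X₂ i * X₂ j + X₂ j * X₂ i) := by
      simp only [add_mul, mul_add, smul_mul_assoc, mul_smul_comm]
      module
    rw [e, h₁.XX, hXX, hXX, h₂.XX]; simp
  YY i j := by
    have e : (r • Y₁ i + s • Y₂ i) * (r • Y₁ j + s • Y₂ j) +
        (r • Y₁ j + s • Y₂ j) * (r • Y₁ i + s • Y₂ i) =
        (r * r) • (Y₁ i * Y₁ j + Y₁ j * Y₁ i) + (r * s) • (Y₁ i * Y₂ j + Y₂ j * Y₁ i) +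
        (r * s) • (Y₁ j * Y₂ i + Y₂ i * Y₁ j) + (s * s) • (Y₂ i * Y₂ j + Y₂ j * Y₂ i) := by
      simp only [add_mul, mul_add, smul_mul_assoc, mul_smul_comm]
      module
    rw [e, h₁.YY, hYY, hYY, h₂.YY]; simp
  XY i j := by
    have e : (p • X₁ i + q • X₂ i) * (r • Y₁ j + s • Y₂ j) +
        (r • Y₁ j + s • Y₂ j) * (p • X₁ i + q • X₂ i) =
        (p * r) • (X₁ i * Y₁ j + Y₁ j * X₁ i) + (p * s) • (X₁ i * Y₂ j + Y₂ j * X₁ i) +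
        (q * r) • (Y₁ j * X₂ i + X₂ i * Y₁ j) + (q * s) • (X₂ i * Y₂ j + Y₂ j * X₂ i) := by
      simp only [add_mul, mul_add, smul_mul_assoc, mul_smul_comm]
      module
    rw [e, h₁.XY, hXY, hYX, h₂.XY, smul_zero, smul_zero, add_zero, add_zero, ← add_smul, hpr,
      one_smul]
  X_vac l hl := by simp [h₁.X_vac l hl, h₂.X_vac l hl]
  Y_vac l hl := by simp [h₁.Y_vac l hl, h₂.Y_vac l hl]
  bra_X l hl v := by simp [h₁.bra_X l hl, h₂.bra_X l hl]
  bra_Y l hl v := by simp [h₁.bra_Y l hl, h₂.bra_Y l hl]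
  X_create c := by
    refine ((h₁.X_create c).union (h₂.X_create c)).subset fun l hl => ?_
    by_contra hc
    simp only [Set.mem_union, Set.mem_ofPred_eq, not_or, not_not] at hc
    refine hl ?_
    have e : (p • X₁ l + q • X₂ l) * create c + create c * (p • X₁ l + q • X₂ l) =
        p • (X₁ l * create c + create c * X₁ l) + q • (X₂ l * create c + create c * X₂ l) := by
      simp only [add_mul, mul_add, smul_mul_assoc, mul_smul_comm]
      module
    rw [e, hc.1, hc.2]; simp
  Y_create c := by
    refine ((h₁.Y_create c).union (h₂.Y_create c)).subset fun l hl => ?_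
    by_contra hc
    simp only [Set.mem_union, Set.mem_ofPred_eq, not_or, not_not] at hc
    refine hl ?_
    have e : (r • Y₁ l + s • Y₂ l) * create c + create c * (r • Y₁ l + s • Y₂ l) =
        r • (Y₁ l * create c + create c * Y₁ l) + s • (Y₂ l * create c + create c * Y₂ l) := by
      simp only [add_mul, mul_add, smul_mul_assoc, mul_smul_comm]
      module
    rw [e, hc.1, hc.2]; simp

end IsCharged

/-! ## The two components as families of charged fermions -/

theorem isCharged_psiC_zero : IsCharged (psiC 0) (psiDagC 0) where
  XX := psiC_psiC 0 0
  YY := psiDagC_psiDagC 0 0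
  XY i j := by rw [psiC_psiDagC]; simp
  X_vac _ hl := psiC_vac 0 hl
  Y_vac _ hl := psiDagC_vac 0 hl
  bra_X l hl v := by rw [psiC, if_pos hl, bra0_create]
  bra_Y l hl v := by rw [psiDagC, if_neg (not_le.2 hl), bra0_create]
  X_create := psiC_create_finite 0
  Y_create := psiDagC_create_finite 0

/-- The reflection i ↦ -1 - i exchanges i < 0 with i ≥ 0. It compensates for the exchange of ψ and
ψ†, so the second component has the vacuum conditions of the first and can be mixed with it. -/
theorem isCharged_conj_one :
    IsCharged (fun i => psiDagC 1 (-1 - i)) (fun i => psiC 1 (-1 - i)) where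
  XX i j := psiDagC_psiDagC 1 1 _ _
  YY i j := psiC_psiC 1 1 _ _
  XY i j := by
    rw [add_comm, psiC_psiDagC]
    simp [eq_comm]
  X_vac _ hl := psiDagC_vac 1 (by omega)
  Y_vac _ hl := psiC_vac 1 (by omega)
  bra_X l hl v := by rw [psiDagC, if_neg (by omega), bra0_create]
  bra_Y l hl v := by rw [psiC, if_pos (by omega), bra0_create]
  X_create c := (psiDagC_create_finite 1 c).preimage (f := fun l : ℤ => -1 - l)
    (fun x _ y _ h => by simpa using h)
  Y_create c := (psiC_create_finite 1 c).preimage (f := fun l : ℤ => -1 - l)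
    (fun x _ y _ h => by simpa using h)

/-- `(p ψ^{(1)}_j + q ψ^{†(2)}_{-1-j})` and its conjugate `(r ψ^{†(1)}_j + s ψ^{(2)}_{-1-j})`. -/
theorem isCharged_mix {p q r s : ℂ} (h : p * r + q * s = 1) :
    IsCharged (fun i => p • psiC 0 i + q • psiDagC 1 (-1 - i))
      (fun i => r • psiDagC 0 i + s • psiC 1 (-1 - i)) :=
  isCharged_psiC_zero.smul_add isCharged_conj_one
    (fun i j => by rw [psiC_psiDagC]; simp) (fun i j => by rw [add_comm, psiC_psiDagC]; simp)
    (fun i j => psiC_psiC _ _ _ _) (fun i j => psiDagC_psiDagC _ _ _ _) h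

theorem isCharged_psiB : IsCharged psiB psiDagB := by
  have := isCharged_mix (p := ((Real.sqrt 2 : ℝ) : ℂ)⁻¹) (q := ((Real.sqrt 2 : ℝ) : ℂ)⁻¹)
    (r := ((Real.sqrt 2 : ℝ) : ℂ)⁻¹) (s := ((Real.sqrt 2 : ℝ) : ℂ)⁻¹)
    (by rw [inv_sqrt_two_mul_self]; norm_num)
  simp only [← smul_add] at this
  exact this

theorem current_psiB : current isCharged_psiB = beta := rfl

/-- The fermions `ψ'_j = (ψ^{(1)}_j - ψ^{†(2)}_{-1-j})/(i√2)`, which anticommute with all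
`ψ_j, ψ†_j`. -/
def psiB' (j : ℤ) : Op :=
  (-Complex.I * ((Real.sqrt 2 : ℝ) : ℂ)⁻¹) • psiC 0 j +
    (Complex.I * ((Real.sqrt 2 : ℝ) : ℂ)⁻¹) • psiDagC 1 (-1 - j)

/-- The fermions `ψ'†_j = i(ψ^{†(1)}_j - ψ^{(2)}_{-1-j})/√2`. -/
def psiDagB' (j : ℤ) : Op :=
  (Complex.I * ((Real.sqrt 2 : ℝ) : ℂ)⁻¹) • psiDagC 0 j +
    (-Complex.I * ((Real.sqrt 2 : ℝ) : ℂ)⁻¹) • psiC 1 (-1 - j)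

theorem isCharged_psiB' : IsCharged psiB' psiDagB' :=
  isCharged_mix (by
    have h := inv_sqrt_two_mul_self
    linear_combination (-2 * Complex.I ^ 2) * h - Complex.I_sq)

theorem psiC_zero_eq (j : ℤ) :
    psiC 0 j = ((Real.sqrt 2 : ℝ) : ℂ)⁻¹ • (psiB j + Complex.I • psiB' j) := by
  have h := inv_sqrt_two_mul_self
  rw [psiB, psiB']
  match_scalars
  · linear_combination (-1 + Complex.I ^ 2) * h + Complex.I_sq / 2
  · linear_combination (-1 - Complex.I ^ 2) * h - Complex.I_sq / 2

theorem psiDagC_one_eq (j : ℤ) : psiDagC 1 (-1 - j) =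
    ((Real.sqrt 2 : ℝ) : ℂ)⁻¹ • (psiB j + (-Complex.I) • psiB' j) := by
  have h := inv_sqrt_two_mul_self
  rw [psiB, psiB']
  match_scalars
  · linear_combination (-1 + Complex.I ^ 2) * h + Complex.I_sq / 2
  · linear_combination (-1 - Complex.I ^ 2) * h - Complex.I_sq / 2

theorem psiDagC_zero_eq (j : ℤ) :
    psiDagC 0 j = ((Real.sqrt 2 : ℝ) : ℂ)⁻¹ • (psiDagB j + (-Complex.I) • psiDagB' j) := by
  have h := inv_sqrt_two_mul_self
  rw [psiDagB, psiDagB']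
  match_scalars
  · linear_combination (-1 + Complex.I ^ 2) * h + Complex.I_sq / 2
  · linear_combination (-1 - Complex.I ^ 2) * h - Complex.I_sq / 2

theorem psiC_one_eq (j : ℤ) : psiC 1 (-1 - j) =
    ((Real.sqrt 2 : ℝ) : ℂ)⁻¹ • (psiDagB j + Complex.I • psiDagB' j) := by
  have h := inv_sqrt_two_mul_self
  rw [psiDagB, psiDagB']
  match_scalars
  · linear_combination (-1 + Complex.I ^ 2) * h + Complex.I_sq / 2
  · linear_combination (-1 - Complex.I ^ 2) * h - Complex.I_sq / 2

/-! ### The two type-B families anticommute -/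

theorem anticomm_smul_add_smul (p q r s : ℂ) (x y z w : Op) :
    (p • x + q • y) * (r • z + s • w) + (r • z + s • w) * (p • x + q • y) =
      (p * r) • (x * z + z * x) + (p * s) • (x * w + w * x) + (q * r) • (y * z + z * y) +
        (q * s) • (y * w + w * y) := by
  simp only [add_mul, mul_add, smul_mul_assoc, mul_smul_comm]
  module

theorem psiB'_psiB (i j : ℤ) : psiB' i * psiB j + psiB j * psiB' i = 0 := by
  rw [psiB, psiB', smul_add, anticomm_smul_add_smul, psiC_psiC, psiC_psiDagC, psiDagC_psiDagC,
    add_comm (psiDagC 1 (-1 - i) * _), psiC_psiDagC]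
  simp

theorem psiDagB'_psiDagB (i j : ℤ) : psiDagB' i * psiDagB j + psiDagB j * psiDagB' i = 0 := by
  rw [psiDagB, psiDagB', smul_add, anticomm_smul_add_smul, psiDagC_psiDagC,
    add_comm (psiDagC 0 i * _), psiC_psiDagC, psiC_psiDagC, psiC_psiC]
  simp

theorem psiB'_psiDagB (i j : ℤ) : psiB' i * psiDagB j + psiDagB j * psiB' i = 0 := by
  rw [psiDagB, psiB', smul_add, anticomm_smul_add_smul, psiC_psiDagC, psiC_psiC, psiDagC_psiDagC,
    add_comm (psiDagC 1 (-1 - i) * _), psiC_psiDagC]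
  by_cases h : i = j
  · subst h; simp
  · simp [h, Ne.symm h]

theorem psiDagB'_psiB (i j : ℤ) : psiDagB' i * psiB j + psiB j * psiDagB' i = 0 := by
  rw [psiB, psiDagB', smul_add, anticomm_smul_add_smul, add_comm (psiDagC 0 i * _), psiC_psiDagC,
    psiC_psiC, psiDagC_psiDagC, psiC_psiDagC]
  by_cases h : i = j
  · subst h; simp
  · simp [h, Ne.symm h]

/-! ### Decomposition of the currents -/

theorem pair_commute {x y z w : Op} (hxz : x * z + z * x = 0) (hxw : x * w + w * x = 0)
    (hyz : y * z + z * y = 0) (hyw : y * w + w * y = 0) : Commute (x * y) (z * w) :=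
  (mul_pair_comm (eq_neg_of_add_eq_zero_left hxz) (eq_neg_of_add_eq_zero_left hyz)).mul_right
    (mul_pair_comm (eq_neg_of_add_eq_zero_left hxw) (eq_neg_of_add_eq_zero_left hyw))

/-- An operator that anticommutes with a family of fermions commutes with its currents. -/
theorem commute_current {X Y : ℤ → Op} (h : IsCharged X Y) {T : Op}
    (hX : ∀ l, T * X l + X l * T = 0) (hY : ∀ l, T * Y l + Y l * T = 0) (k : ℤ) :
    Commute T (current h k) :=
  Commute.locFinSum_right _ _ fun _ => Commute.normalProd_right
    (mul_pair_comm (eq_neg_of_add_eq_zero_right (hX _))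
      (eq_neg_of_add_eq_zero_right (hY _))).symm

theorem current_commute_current {X Y X' Y' : ℤ → Op} (h : IsCharged X Y) (h' : IsCharged X' Y')
    (hXX : ∀ i j, X i * X' j + X' j * X i = 0) (hYY : ∀ i j, Y i * Y' j + Y' j * Y i = 0)
    (hXY : ∀ i j, X i * Y' j + Y' j * X i = 0) (hYX : ∀ i j, Y i * X' j + X' j * Y i = 0)
    (k l : ℤ) : Commute (current h k) (current h' l) :=
  Commute.locFinSum_right _ _ fun _ => Commute.normalProd_right (Commute.symm
    (Commute.locFinSum_right _ _ fun _ => Commute.normalProd_right (Commute.symm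
      (pair_commute (hXX _ _) (hXY _ _) (hYX _ _) (hYY _ _)))))

/-- The currents `∑_l :ψ'_l ψ'†_{l+k}:`. -/
abbrev beta' : ℤ → Op := current isCharged_psiB'

theorem beta'_commute_beta (k l : ℤ) : Commute (beta' k) (beta l) :=
  current_commute_current isCharged_psiB' isCharged_psiB psiB'_psiB psiDagB'_psiDagB psiB'_psiDagB
    psiDagB'_psiB k l

/-- The daggered fermions transform contragrediently to the undaggered ones, so the pairing ∑ x x†
over the two families is preserved and the cross terms cancel. -/
theorem normalProd_psiC_add (l m : ℤ) :
    normalProd (psiC 0 l) (psiDagC 0 m) + normalProd (psiDagC 1 (-1 - l)) (psiC 1 (-1 - m)) =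
      normalProd (psiB l) (psiDagB m) + normalProd (psiB' l) (psiDagB' m) := by
  have h := inv_sqrt_two_mul_self
  simp only [psiB, psiDagB, psiB', psiDagB', smul_add, normalProd_add_left, normalProd_add_right,
    normalProd_smul_left, normalProd_smul_right]
  match_scalars
  · linear_combination (-1 + Complex.I ^ 2) * h + Complex.I_sq / 2
  · linear_combination (-1 + Complex.I ^ 2) * h + Complex.I_sq / 2
  · linear_combination (-1 - Complex.I ^ 2) * h - Complex.I_sq / 2
  · linear_combination (-1 - Complex.I ^ 2) * h - Complex.I_sq / 2

/-- Swapping the two factors of each normally ordered product gives the sign; the substitution l ↦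
-1 - k - l then recovers the sum for `alpha 1 k`. -/
theorem current_conj_one (k : ℤ) : current isCharged_conj_one k = -alpha 1 k := by
  have key : ∀ l, normalProd (psiDagC 1 (-1 - l)) (psiC 1 (-1 - (l + k))) =
      -normalProd (psiC 1 (-1 - k - l)) (psiDagC 1 (-1 - k - l + k)) := fun l => by
    rw [show -1 - k - l + k = -1 - l by ring, show -1 - k - l = -1 - (l + k) by ring]
    refine normalProd_add_swap (c := if -1 - (l + k) = -1 - l then 1 else 0) ?_
    rw [add_comm, psiC_psiDagC]
    simp
  refine LinearMap.ext fun v => ?_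
  calc current isCharged_conj_one k v
      = ∑ᶠ l, -(normalProd (psiC 1 (-1 - k - l)) (psiDagC 1 (-1 - k - l + k)) v) :=
        finsum_congr fun l => congrArg (fun W : Op => W v) (key l)
    _ = -∑ᶠ l, normalProd (psiC 1 (-1 - k - l)) (psiDagC 1 (-1 - k - l + k)) v :=
        finsum_neg_distrib _
    _ = -(alpha 1 k v) := congrArg Neg.neg (finsum_comp_equiv (Equiv.subLeft (-1 - k))
        (f := fun l => normalProd (psiC 1 l) (psiDagC 1 (l + k)) v))

theorem alpha_sub_alpha (k : ℤ) : alpha 0 k - alpha 1 k = beta k + beta' k := by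
  have e : alpha 0 k - alpha 1 k = current isCharged_psiC_zero k + current isCharged_conj_one k := by
    rw [current_conj_one, sub_eq_add_neg]; rfl
  rw [e]
  refine LinearMap.ext fun v => ?_
  rw [← current_psiB]
  simp only [LinearMap.add_apply, current, locFinSum_apply]
  rw [← finsum_add_distrib, ← finsum_add_distrib]
  · exact finsum_congr fun l => congrArg (fun W : Op => W v) (normalProd_psiC_add l (l + k))
  · exact locFin_normalProd _ _ k isCharged_psiB.X_vac isCharged_psiB.Y_vac isCharged_psiB.XY
      isCharged_psiB.X_create isCharged_psiB.Y_create v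
  · exact locFin_normalProd _ _ k isCharged_psiB'.X_vac isCharged_psiB'.Y_vac isCharged_psiB'.XY
      isCharged_psiB'.X_create isCharged_psiB'.Y_create v
  · exact locFin_normalProd _ _ k isCharged_psiC_zero.X_vac isCharged_psiC_zero.Y_vac
      isCharged_psiC_zero.XY isCharged_psiC_zero.X_create isCharged_psiC_zero.Y_create v
  · exact locFin_normalProd _ _ k isCharged_conj_one.X_vac isCharged_conj_one.Y_vac
      isCharged_conj_one.XY isCharged_conj_one.X_create isCharged_conj_one.Y_create v

/-! ## Formal exponentials -/

/-- `IsNilpotent.exp` has rational coefficients; complex ones are needed for membership in complex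
subalgebras. -/
theorem exp_eq_sum_complex {q : Op} {k : ℕ} (h : q ^ k = 0) :
    IsNilpotent.exp q = ∑ i ∈ Finset.range k, ((i ! : ℂ)⁻¹) • q ^ i := by
  rw [IsNilpotent.exp_eq_sum h]
  refine Finset.sum_congr rfl fun i _ => LinearMap.ext fun v => ?_
  change (algebraMap ℚ ℂ ((i ! : ℚ)⁻¹)) • (q ^ i) v = _
  simp

theorem exp_of_sq_eq_zero {q : Op} (h : q * q = 0) : IsNilpotent.exp q = 1 + q := by
  rw [exp_eq_sum_complex (k := 2) (by rw [pow_two, h])]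
  simp [Finset.sum_range_succ]

/-- A subalgebra of `Op × Op` that contains a pair of nilpotent operators contains the pair of their
exponentials. -/
theorem exp_mem_subalgebra (K : Subalgebra ℂ (Op × Op)) {q q' : Op} (hq : IsNilpotent q)
    (hq' : IsNilpotent q') (h : (q, q') ∈ K) :
    (IsNilpotent.exp q, IsNilpotent.exp q') ∈ K := by
  obtain ⟨m, hm⟩ := hq
  obtain ⟨n, hn⟩ := hq'
  rw [exp_eq_sum_complex (pow_eq_zero_of_le (le_max_left m n) hm),
    exp_eq_sum_complex (pow_eq_zero_of_le (le_max_right m n) hn)]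
  have e : (∑ i ∈ Finset.range (max m n), ((i ! : ℂ)⁻¹) • q ^ i,
      ∑ i ∈ Finset.range (max m n), ((i ! : ℂ)⁻¹) • q' ^ i) =
      ∑ i ∈ Finset.range (max m n), ((i ! : ℂ)⁻¹) • (q, q') ^ i := by
    ext1 <;> simp [Prod.fst_sum, Prod.snd_sum]
  rw [e]
  exact K.sum_mem fun i _ => K.smul_mem (K.pow_mem h i) _

/-- The operator coefficients of `e^{∑_i t_i B_i}`. -/
def evolCoeff (B : ℤ → Op) (d : ℤ →₀ ℕ) : Op := MvPowerSeries.coeff d (seriesExp (timeSeries B))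

theorem coeff_evolve (u : Fock →ₗ[ℂ] ℂ) (B : ℤ → Op) (v : Fock) (d : ℤ →₀ ℕ) :
    MvPowerSeries.coeff d (evolve u B v) = u (evolCoeff B d v) := rfl

theorem coeff_seriesExp (T : MvPowerSeries ℤ Op) (d : ℤ →₀ ℕ) :
    MvPowerSeries.coeff d (seriesExp T) =
      ∑ k ∈ Finset.range (d.degree + 1), ((k ! : ℂ)⁻¹) • MvPowerSeries.coeff d (T ^ k) := rfl

theorem coeff_timeSeries (B : ℤ → Op) (d : ℤ →₀ ℕ) :
    MvPowerSeries.coeff d (timeSeries B) =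
      ∑ i ∈ d.support, if d = Finsupp.single i 1 then B i else 0 := rfl

/-- Each coefficient is a noncommutative polynomial in the `B k`, the same polynomial for `B'`.
Pairs of operators let one argument serve both for comparing two families and, with a factor ⊤, for
properties of a single one. -/
theorem coeff_pow_timeSeries_mem (K : Subalgebra ℂ (Op × Op)) {B B' : ℤ → Op}
    (h : ∀ k, (B k, B' k) ∈ K) (k : ℕ) (d : ℤ →₀ ℕ) :
    (MvPowerSeries.coeff d (timeSeries B ^ k), MvPowerSeries.coeff d (timeSeries B' ^ k)) ∈ K := by
  classical
  induction k generalizing d with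
  | zero =>
    simp only [pow_zero, MvPowerSeries.coeff_one]
    split_ifs
    · exact K.one_mem
    · exact K.zero_mem
  | succ k ih =>
    simp only [pow_succ, MvPowerSeries.coeff_mul, prod_mk_sum]
    refine K.sum_mem fun p _ => ?_
    suffices hp : (MvPowerSeries.coeff p.2 (timeSeries B),
        MvPowerSeries.coeff p.2 (timeSeries B')) ∈ K from K.mul_mem (ih p.1) hp
    simp only [coeff_timeSeries, prod_mk_sum]
    refine K.sum_mem fun i _ => ?_
    split_ifs
    · exact h i
    · exact K.zero_mem

theorem evolCoeff_mem_subalgebra (K : Subalgebra ℂ (Op × Op)) {B B' : ℤ → Op}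
    (h : ∀ k, (B k, B' k) ∈ K) (d : ℤ →₀ ℕ) : (evolCoeff B d, evolCoeff B' d) ∈ K := by
  simp only [evolCoeff, coeff_seriesExp, prod_mk_sum]
  exact K.sum_mem fun k _ => K.smul_mem (coeff_pow_timeSeries_mem K h k d) _

theorem commute_evolCoeff {T : Op} {B : ℤ → Op} (h : ∀ k, Commute T (B k)) (d : ℤ →₀ ℕ) :
    Commute T (evolCoeff B d) := by
  have := evolCoeff_mem_subalgebra ((Subalgebra.centralizer ℂ {T}).prod ⊤) (B := B) (B' := B)
    (fun k => ⟨(Subalgebra.mem_centralizer_iff ℂ).2 (by simpa using (h k).eq), trivial⟩) d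
  exact (Subalgebra.mem_centralizer_iff ℂ).1 this.1 T rfl

theorem commute_exp {T q : Op} (hq : IsNilpotent q) (h : Commute T q) :
    Commute T (IsNilpotent.exp q) := by
  obtain ⟨k, hk⟩ := hq
  rw [exp_eq_sum_complex hk]
  exact Commute.sum_right _ _ _ fun i _ => (h.pow_right i).smul_right _

theorem coeff_pow_eq_zero {T : MvPowerSeries ℤ Op} (hT : MvPowerSeries.constantCoeff T = 0)
    {k : ℕ} {d : ℤ →₀ ℕ} (h : d.degree < k) : MvPowerSeries.coeff d (T ^ k) = 0 := by
  refine MvPowerSeries.coeff_of_lt_order (lt_of_lt_of_le ?_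
    (MvPowerSeries.le_order_pow_of_constantCoeff_eq_zero k hT))
  exact_mod_cast h

theorem coeff_seriesExp_of_le {T : MvPowerSeries ℤ Op} (hT : MvPowerSeries.constantCoeff T = 0)
    {d : ℤ →₀ ℕ} {n : ℕ} (h : d.degree ≤ n) : MvPowerSeries.coeff d (seriesExp T) =
      ∑ k ∈ Finset.range (n + 1), ((k ! : ℂ)⁻¹) • MvPowerSeries.coeff d (T ^ k) := by
  rw [coeff_seriesExp]
  refine Finset.sum_subset (by simpa using h) fun k _ hk => ?_
  rw [coeff_pow_eq_zero hT (by simpa using hk), smul_zero]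

/-- By the binomial theorem both sides are sums of T^p T'^q / (p! q!): on the left over p + q ≤ n,
on the right over the square p, q ≤ n, with n the degree of the monomial. The terms with p + q > n
have order greater than n and do not contribute. -/
theorem seriesExp_add {T T' : MvPowerSeries ℤ Op} (hT : MvPowerSeries.constantCoeff T = 0)
    (hT' : MvPowerSeries.constantCoeff T' = 0) (hc : Commute T T') :
    seriesExp (T + T') = seriesExp T * seriesExp T' := by
  classical
  ext1 d
  set n := d.degree with hn
  have hR : MvPowerSeries.coeff d (seriesExp T * seriesExp T') =
      ∑ p ∈ Finset.range (n + 1) ×ˢ Finset.range (n + 1), ((p.1 ! : ℂ)⁻¹ * (p.2 ! : ℂ)⁻¹) •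
        MvPowerSeries.coeff d (T ^ p.1 * T' ^ p.2) := by
    simp only [MvPowerSeries.coeff_mul, Finset.smul_sum]
    rw [Finset.sum_comm]
    refine Finset.sum_congr rfl fun e he => ?_
    have hd : e.1.degree + e.2.degree = n := by
      rw [← map_add, Finset.HasAntidiagonal.mem_antidiagonal.1 he]
    rw [coeff_seriesExp_of_le hT (show e.1.degree ≤ n by omega),
      coeff_seriesExp_of_le hT' (show e.2.degree ≤ n by omega), Finset.sum_mul_sum,
      Finset.sum_product]
    simp only [smul_mul_smul_comm]
  have hL : MvPowerSeries.coeff d (seriesExp (T + T')) =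
      ∑ k ∈ Finset.range (n + 1), ∑ p ∈ Finset.HasAntidiagonal.antidiagonal k, ((p.1 ! : ℂ)⁻¹ * (p.2 ! : ℂ)⁻¹) •
        MvPowerSeries.coeff d (T ^ p.1 * T' ^ p.2) := by
    rw [coeff_seriesExp]
    refine Finset.sum_congr rfl fun k _ => ?_
    rw [hc.add_pow', map_sum, Finset.smul_sum]
    refine Finset.sum_congr rfl fun p hp => ?_
    rw [map_nsmul, ← Nat.cast_smul_eq_nsmul ℂ, smul_smul]
    congr 1
    rw [Finset.HasAntidiagonal.mem_antidiagonal] at hp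
    subst hp
    rw [Nat.cast_add_choose]
    have := Nat.factorial_ne_zero (p.1 + p.2)
    field_simp
  rw [hL, hR]
  symm
  rw [← Finset.sum_filter_add_sum_filter_not _ (fun p : ℕ × ℕ => p.1 + p.2 ∈ Finset.range (n + 1)),
    add_eq_left.2, ← Finset.sum_fiberwise_of_maps_to (t := Finset.range (n + 1))
      (g := fun p : ℕ × ℕ => p.1 + p.2)]
  · refine Finset.sum_congr rfl fun k hk => Finset.sum_congr ?_ fun _ _ => rfl
    ext p
    simp only [Finset.mem_filter, Finset.mem_product, Finset.mem_range, Finset.HasAntidiagonal.mem_antidiagonal] at *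
    omega
  · intro p hp
    exact (Finset.mem_filter.1 hp).2
  · refine Finset.sum_eq_zero fun p hp => ?_
    rw [MvPowerSeries.coeff_of_lt_order, smul_zero]
    refine lt_of_lt_of_le ?_ (MvPowerSeries.le_order_mul)
    refine lt_of_lt_of_le ?_ (add_le_add
      (MvPowerSeries.le_order_pow_of_constantCoeff_eq_zero p.1 hT)
      (MvPowerSeries.le_order_pow_of_constantCoeff_eq_zero p.2 hT'))
    have := (Finset.mem_filter.1 hp).2
    rw [Finset.mem_range, not_lt] at this
    exact_mod_cast this

theorem timeSeries_add (B B' : ℤ → Op) :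
    timeSeries (fun k => B k + B' k) = timeSeries B + timeSeries B' := by
  ext1 d
  rw [map_add]
  simp only [coeff_timeSeries, ← Finset.sum_add_distrib]
  refine Finset.sum_congr rfl fun i _ => ?_
  split_ifs <;> simp

theorem constantCoeff_timeSeries (B : ℤ → Op) :
    MvPowerSeries.constantCoeff (timeSeries B) = 0 := by
  rw [← MvPowerSeries.coeff_zero_eq_constantCoeff_apply, coeff_timeSeries]
  simp

theorem commute_coeff_timeSeries {T : Op} {B : ℤ → Op} (h : ∀ k, Commute T (B k)) (d : ℤ →₀ ℕ) :
    Commute T (MvPowerSeries.coeff d (timeSeries B)) := by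
  rw [coeff_timeSeries]
  refine Commute.sum_right _ _ _ fun i _ => ?_
  split_ifs
  · exact h i
  · exact Commute.zero_right _

theorem commute_timeSeries {B B' : ℤ → Op} (h : ∀ k l, Commute (B k) (B' l)) :
    Commute (timeSeries B) (timeSeries B') := by
  classical
  ext1 d
  rw [MvPowerSeries.coeff_mul, MvPowerSeries.coeff_mul,
    Finsupp.sum_antidiagonal_swap d fun a b =>
      MvPowerSeries.coeff a (timeSeries B') * MvPowerSeries.coeff b (timeSeries B)]
  exact Finset.sum_congr rfl fun p _ => commute_coeff_timeSeries
    (fun l => (commute_coeff_timeSeries (fun k => (h k l).symm) p.1).symm) p.2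

theorem evolCoeff_add {B B' : ℤ → Op} (h : ∀ k l, Commute (B k) (B' l)) (d : ℤ →₀ ℕ) :
    evolCoeff (fun k => B k + B' k) d =
      ∑ p ∈ Finset.HasAntidiagonal.antidiagonal d, evolCoeff B p.1 * evolCoeff B' p.2 := by
  classical
  rw [evolCoeff, timeSeries_add, seriesExp_add (constantCoeff_timeSeries B)
    (constantCoeff_timeSeries B') (commute_timeSeries h), MvPowerSeries.coeff_mul]
  rfl

/-- In the definition the list of naturals is cast to a list of integers through the list monad;
here the index runs over ℕ itself. -/
theorem PsiDag_eq (x xd : ℤ → Op) (n : ℤ) : PsiDag x xd n =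
    if 0 ≤ n then ((List.range n.toNat).map fun k : ℕ => xd (k : ℤ)).prod
    else ((List.range (-n).toNat).map fun k : ℕ => x (-1 - (k : ℤ))).prod := by
  have e : ∀ (l : List ℕ) (f : ℤ → Op),
      List.map (fun k : ℤ => f k) (do let a ← l; pure ↑a) = l.map fun k : ℕ => f k := by
    intro l f
    induction l with
    | nil => rfl
    | cons a l ih => simpa using ih
  unfold PsiDag
  rw [e, e (List.range (-n).toNat) fun k => x (-1 - k)]

/-! ## Comparison of vacuum expectation values -/

/-- The graph of the correspondence between the states generated from `v` by the creation operators
of the family `X, Y` and the states generated from `v'` by those of `X', Y'`. -/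
inductive Corr (X Y X' Y' : ℤ → Op) (v v' : Fock) : Fock → Fock → Prop
  | base : Corr X Y X' Y' v v' v v'
  | add {x x' y y'} : Corr X Y X' Y' v v' x x' → Corr X Y X' Y' v v' y y' →
      Corr X Y X' Y' v v' (x + y) (x' + y')
  | smul (r : ℂ) {x x'} : Corr X Y X' Y' v v' x x' → Corr X Y X' Y' v v' (r • x) (r • x')
  | createX {l : ℤ} (hl : 0 ≤ l) {x x'} : Corr X Y X' Y' v v' x x' →
      Corr X Y X' Y' v v' (X l x) (X' l x')
  | createY {l : ℤ} (hl : l < 0) {x x'} : Corr X Y X' Y' v v' x x' →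
      Corr X Y X' Y' v v' (Y l x) (Y' l x')

/-- `v` is annihilated by the annihilation operators of the family `X, Y`. -/
structure IsVacuum (X Y : ℤ → Op) (v : Fock) : Prop where
  X_eq : ∀ l < 0, X l v = 0
  Y_eq : ∀ l, 0 ≤ l → Y l v = 0

theorem IsCharged.isVacuum {X Y : ℤ → Op} (h : IsCharged X Y) : IsVacuum X Y vac := ⟨h.X_vac, h.Y_vac⟩

theorem apply_apply_of_anticomm {x y : Op} {c : ℂ} (h : x * y + y * x = c • (1 : Op)) (v : Fock) :
    x (y v) = c • v + (-1 : ℂ) • y (x v) := by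
  have := congrArg (fun W : Op => W v) h
  simp only [LinearMap.add_apply, Module.End.mul_apply, LinearMap.smul_apply,
    Module.End.one_apply] at this
  rw [← this]; module

namespace Corr

variable {X Y X' Y' : ℤ → Op} {v v' : Fock}

theorem zero : Corr X Y X' Y' v v' 0 0 := by
  simpa using Corr.smul 0 (Corr.base (X := X) (Y := Y) (X' := X') (Y' := Y') (v := v) (v' := v'))

/-- ⟨0| kills everything in the image of a creation operator, so only the multiples of the base
vectors survive, and these multiples agree. The cross-multiplied form remains valid when ⟨0|v⟩ = 0,
as happens for v = φ|0⟩. -/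
theorem bra0_mul (h : IsCharged X Y) (h' : IsCharged X' Y') {x x' : Fock}
    (hx : Corr X Y X' Y' v v' x x') : bra0 x * bra0 v' = bra0 x' * bra0 v := by
  induction hx with
  | base => ring
  | add _ _ h₁ h₂ => rw [map_add, map_add]; linear_combination h₁ + h₂
  | smul r _ h₁ => rw [map_smul, map_smul, smul_eq_mul, smul_eq_mul]; linear_combination r * h₁
  | createX hl _ _ => rw [h.bra_X _ hl, h'.bra_X _ hl]; ring
  | createY hl _ _ => rw [h.bra_Y _ hl, h'.bra_Y _ hl]; ring

/-- The operator is moved to the right past the creation operators by the anticommutation relations,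
which have the same scalars in both families. At the base vector it either annihilates or is itself
a creation operator. -/
theorem apply_X_and_apply_Y (h : IsCharged X Y) (h' : IsCharged X' Y') (hv : IsVacuum X Y v)
    (hv' : IsVacuum X' Y' v') {x x' : Fock} (hx : Corr X Y X' Y' v v' x x') (l : ℤ) :
    Corr X Y X' Y' v v' (X l x) (X' l x') ∧ Corr X Y X' Y' v v' (Y l x) (Y' l x') := by
  have step : ∀ {x y x₁ y₁ : Op} {w w' : Fock} {c : ℂ}, x * y + y * x = c • (1 : Op) →
      x₁ * y₁ + y₁ * x₁ = c • (1 : Op) → Corr X Y X' Y' v v' w w' →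
      Corr X Y X' Y' v v' (y (x w)) (y₁ (x₁ w')) →
      Corr X Y X' Y' v v' (x (y w)) (x₁ (y₁ w')) := by
    intro x y x₁ y₁ w w' c e e₁ hw hyx
    rw [apply_apply_of_anticomm e, apply_apply_of_anticomm e₁]
    exact (hw.smul c).add (hyx.smul (-1))
  have hXY : ∀ i j, X i * Y j + Y j * X i = (if i = j then (1 : ℂ) else 0) • (1 : Op) := fun i j => by
    rw [h.XY]; split_ifs <;> simp
  have hXY' : ∀ i j, X' i * Y' j + Y' j * X' i = (if i = j then (1 : ℂ) else 0) • (1 : Op) :=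
    fun i j => by rw [h'.XY]; split_ifs <;> simp
  induction hx with
  | base =>
    constructor
    · rcases lt_or_ge l 0 with hl | hl
      · rw [hv.X_eq l hl, hv'.X_eq l hl]; exact zero
      · exact base.createX hl
    · rcases lt_or_ge l 0 with hl | hl
      · exact base.createY hl
      · rw [hv.Y_eq l hl, hv'.Y_eq l hl]; exact zero
  | add _ _ h₁ h₂ => simp only [map_add]; exact ⟨h₁.1.add h₂.1, h₁.2.add h₂.2⟩
  | smul r _ h₁ => simp only [map_smul]; exact ⟨h₁.1.smul r, h₁.2.smul r⟩
  | @createX m hm _ _ h₀ h₁ =>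
    refine ⟨step (c := 0) ?_ ?_ h₀ (h₁.1.createX hm), step ((add_comm _ _).trans (hXY m l))
      ((add_comm _ _).trans (hXY' m l)) h₀ (h₁.2.createX hm)⟩
    · rw [h.XX, zero_smul]
    · rw [h'.XX, zero_smul]
  | @createY m hm _ _ h₀ h₁ =>
    refine ⟨step (hXY l m) (hXY' l m) h₀ (h₁.1.createY hm), step (c := 0) ?_ ?_ h₀ (h₁.2.createY hm)⟩
    · rw [h.YY, zero_smul]
    · rw [h'.YY, zero_smul]

end Corr

/-- The pairs of operators that respect the correspondence `Corr`. -/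
def corrAlgebra (X Y X' Y' : ℤ → Op) (v v' : Fock) : Subalgebra ℂ (Op × Op) where
  carrier := {W | ∀ x x', Corr X Y X' Y' v v' x x' → Corr X Y X' Y' v v' (W.1 x) (W.2 x')}
  mul_mem' h₁ h₂ _ _ hx := h₁ _ _ (h₂ _ _ hx)
  add_mem' h₁ h₂ _ _ hx := (h₁ _ _ hx).add (h₂ _ _ hx)
  algebraMap_mem' r _ _ hx := hx.smul r

section

variable {X Y X' Y' : ℤ → Op} {v v' : Fock} (h : IsCharged X Y) (h' : IsCharged X' Y')
  (hv : IsVacuum X Y v) (hv' : IsVacuum X' Y' v')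

include h h'

theorem bra0_mul_of_mem_corrAlgebra {W W' : Op} (hW : (W, W') ∈ corrAlgebra X Y X' Y' v v') :
    bra0 (W v) * bra0 v' = bra0 (W' v') * bra0 v :=
  (hW _ _ Corr.base).bra0_mul h h'

include hv hv'

theorem X_mem_corrAlgebra (l : ℤ) : (X l, X' l) ∈ corrAlgebra X Y X' Y' v v' :=
  fun _ _ hx => (hx.apply_X_and_apply_Y h h' hv hv' l).1

theorem Y_mem_corrAlgebra (l : ℤ) : (Y l, Y' l) ∈ corrAlgebra X Y X' Y' v v' :=
  fun _ _ hx => (hx.apply_X_and_apply_Y h h' hv hv' l).2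

theorem normalProd_mem_corrAlgebra (l m : ℤ) :
    (normalProd (X l) (Y m), normalProd (X' l) (Y' m)) ∈ corrAlgebra X Y X' Y' v v' := by
  have h1 := (corrAlgebra X Y X' Y' v v').mul_mem (X_mem_corrAlgebra h h' hv hv' l)
    (Y_mem_corrAlgebra h h' hv hv' m)
  have h2 := (corrAlgebra X Y X' Y' v v').smul_mem (corrAlgebra X Y X' Y' v v').one_mem
    (bra0 (X l (Y m vac)))
  have h3 := (corrAlgebra X Y X' Y' v v').sub_mem h1 h2
  have e : bra0 (X l (Y m vac)) = bra0 (X' l (Y' m vac)) := by rw [h.vev, h'.vev]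
  convert h3 using 1
  ext1
  · rfl
  · simp [normalProd, e]

theorem current_mem_corrAlgebra (k : ℤ) :
    (current h k, current h' k) ∈ corrAlgebra X Y X' Y' v v' := by
  classical
  intro x x' hx
  have f₁ := locFin_normalProd _ _ k h.X_vac h.Y_vac h.XY h.X_create h.Y_create x
  have f₂ := locFin_normalProd _ _ k h'.X_vac h'.Y_vac h'.XY h'.X_create h'.Y_create x'
  change Corr X Y X' Y' v v' (current h k x) (current h' k x')
  -- The two sums may have different supports; over the union of the supports they can be compared
  -- term by term.
  rw [current, current, locFinSum_apply_eq_sum _ _ _ (f₁.toFinset ∪ f₂.toFinset) (by simp),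
    locFinSum_apply_eq_sum _ _ _ (f₁.toFinset ∪ f₂.toFinset) (by simp)]
  have key : ∀ s : Finset ℤ, Corr X Y X' Y' v v' (∑ l ∈ s, normalProd (X l) (Y (l + k)) x)
      (∑ l ∈ s, normalProd (X' l) (Y' (l + k)) x') := fun s => by
    induction s using Finset.induction_on with
    | empty => exact Corr.zero
    | insert l s hl ih =>
      rw [Finset.sum_insert hl, Finset.sum_insert hl]
      exact (normalProd_mem_corrAlgebra h h' hv hv' l (l + k) x x' hx).add ih
  exact key _

theorem PsiDag_mem_corrAlgebra (N : ℤ) :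
    (PsiDag X Y N, PsiDag X' Y' N) ∈ corrAlgebra X Y X' Y' v v' := by
  have key : ∀ (f f' : ℕ → Op) (n : ℕ), (∀ k, (f k, f' k) ∈ corrAlgebra X Y X' Y' v v') →
      (((List.range n).map f).prod, ((List.range n).map f').prod) ∈
        corrAlgebra X Y X' Y' v v' := by
    intro f f' n hf
    induction n with
    | zero => exact (corrAlgebra X Y X' Y' v v').one_mem
    | succ n ih =>
      rw [List.prod_range_succ, List.prod_range_succ]
      exact (corrAlgebra X Y X' Y' v v').mul_mem ih (hf n)
  rw [PsiDag_eq, PsiDag_eq]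
  split_ifs
  · exact key _ _ _ fun k => Y_mem_corrAlgebra h h' hv hv' _
  · exact key _ _ _ fun k => X_mem_corrAlgebra h h' hv hv' _

end

/-! ## Ordered products of fermions -/

theorem PsiDag_natAbs (x xd : ℤ → Op) (n : ℤ) : PsiDag x xd n =
    if 0 ≤ n then ((List.range n.natAbs).map fun k : ℕ => xd (k : ℤ)).prod
    else ((List.range n.natAbs).map fun k : ℕ => x (-1 - (k : ℤ))).prod := by
  rw [PsiDag_eq]
  split_ifs with h
  · rw [show n.toNat = n.natAbs by omega]
  · rw [show (-n).toNat = n.natAbs by omega]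

theorem anticomm_prod_range {T : Op} {f : ℕ → Op} (h : ∀ k, T * f k + f k * T = 0) (n : ℕ) :
    T * ((List.range n).map f).prod = ((-1 : ℂ) ^ n) • (((List.range n).map f).prod * T) := by
  induction n with
  | zero => simp
  | succ n ih =>
    rw [List.prod_range_succ, ← mul_assoc, ih, smul_mul_assoc, mul_assoc,
      eq_neg_of_add_eq_zero_left (h n), pow_succ, mul_assoc, mul_neg, mul_neg_one, neg_smul, smul_neg]

theorem prod_range_neg (f : ℕ → Op) (n : ℕ) :
    ((List.range n).map fun k => -f k).prod = ((-1 : ℂ) ^ n) • ((List.range n).map f).prod := by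
  induction n with
  | zero => simp
  | succ n ih =>
    rw [List.prod_range_succ, List.prod_range_succ, ih, smul_mul_assoc, pow_succ, mul_neg,
      mul_neg_one, neg_smul, smul_neg]

/-- Bringing the factors into pairs costs the same reordering sign on both sides, so only one factor
`c` for each pair remains. -/
theorem prod_range_mul_prod_range {x y p q : ℕ → Op} {c : ℂ}
    (h : ∀ k, x k * y k = c • (p k * q k)) (hxy : ∀ k l, x k * y l + y l * x k = 0)
    (hpq : ∀ k l, p k * q l + q l * p k = 0) (n : ℕ) :
    ((List.range n).map x).prod * ((List.range n).map y).prod =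
      c ^ n • (((List.range n).map p).prod * ((List.range n).map q).prod) := by
  have step : ∀ (x y : ℕ → Op), (∀ k l, x k * y l + y l * x k = 0) → ∀ n : ℕ,
      ((List.range (n + 1)).map x).prod * ((List.range (n + 1)).map y).prod =
      ((-1 : ℂ) ^ n) • (((List.range n).map x).prod * ((List.range n).map y).prod *
        (x n * y n)) := by
    intro x y hxy n
    rw [List.prod_range_succ, List.prod_range_succ, mul_assoc, ← mul_assoc (x n),
      anticomm_prod_range (hxy n), smul_mul_assoc, mul_smul_comm]
    simp only [mul_assoc]
  induction n with
  | zero => simp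
  | succ n ih =>
    rw [step x y hxy, step p q hpq, ih, h]
    simp only [smul_mul_assoc, mul_smul_comm, smul_smul]
    congr 1
    ring

theorem anticomm_PsiDag {X Y : ℤ → Op} {T : Op} (hX : ∀ l, T * X l + X l * T = 0)
    (hY : ∀ l, T * Y l + Y l * T = 0) (N : ℤ) :
    T * PsiDag X Y N = ((-1 : ℂ) ^ N.natAbs) • (PsiDag X Y N * T) := by
  rw [PsiDag_natAbs]
  split_ifs
  · exact anticomm_prod_range (fun k => hY k) _
  · exact anticomm_prod_range (fun k => hX _) _

theorem PsiDag_neg (X Y : ℤ → Op) (N : ℤ) :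
    PsiDag (fun i => -X i) (fun i => -Y i) N = ((-1 : ℂ) ^ N.natAbs) • PsiDag X Y N := by
  rw [PsiDag_natAbs, PsiDag_natAbs]
  split_ifs <;> exact prod_range_neg _ _

/-! ## Linear and quadratic combinations of fermions -/

/-- `∑_i a_i X_i`, the index running over `S`. -/
def lin (X : ℤ → Op) (a : ℤ → ℂ) (S : Finset ℤ) : Op := ∑ i ∈ S, a i • X i

/-- `½ ∑_{i,j} A_{ij} X_i X_j`, the indices running over `S`. -/
def quad (X : ℤ → Op) (A : ℤ → ℤ → ℂ) (S : Finset ℤ) : Op :=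
  (2⁻¹ : ℂ) • ∑ i ∈ S, ∑ j ∈ S, A i j • (X i * X j)

theorem lin_neg (X : ℤ → Op) (a : ℤ → ℂ) (S : Finset ℤ) : lin (fun i => -X i) a S = -lin X a S := by
  simp [lin]

theorem quad_neg (X : ℤ → Op) (A : ℤ → ℤ → ℂ) (S : Finset ℤ) :
    quad (fun i => -X i) A S = quad X A S := by
  simp [quad]

theorem anticomm_lin {T : Op} {X : ℤ → Op} (h : ∀ l, T * X l + X l * T = 0) (a : ℤ → ℂ)
    (S : Finset ℤ) : T * lin X a S + lin X a S * T = 0 := by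
  rw [lin, Finset.mul_sum, Finset.sum_mul, ← Finset.sum_add_distrib]
  exact Finset.sum_eq_zero fun i _ => by rw [mul_smul_comm, smul_mul_assoc, ← smul_add, h, smul_zero]

theorem commute_quad {T : Op} {X : ℤ → Op} (h : ∀ l, T * X l + X l * T = 0) (A : ℤ → ℤ → ℂ)
    (S : Finset ℤ) : Commute T (quad X A S) := by
  refine Commute.smul_right (Commute.sum_right _ _ _ fun i _ => Commute.sum_right _ _ _ fun j _ =>
    Commute.smul_right ?_ _) _
  exact (mul_pair_comm (eq_neg_of_add_eq_zero_right (h i)) (eq_neg_of_add_eq_zero_right (h j))).symm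

theorem quad_commute_of_commute {T : Op} {X : ℤ → Op} (h : ∀ i j, Commute (X i * X j) T)
    (A : ℤ → ℤ → ℂ) (S : Finset ℤ) : Commute (quad X A S) T :=
  Commute.smul_left (Commute.sum_left _ _ _ fun i _ => Commute.sum_left _ _ _ fun j _ =>
    Commute.smul_left (h i j) _) _

theorem lin_mul_lin {X : ℤ → Op} (h : ∀ i j, X i * X j + X j * X i = 0) (a : ℤ → ℂ)
    (S : Finset ℤ) : lin X a S * lin X a S = 0 := by
  refine sq_zero_of_anticomm (anticomm_lin (fun l => ?_) a S)
  rw [add_comm]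
  exact anticomm_lin (fun k => h l k) a S

/-- The summands commute with each other and have square zero. -/
theorem isNilpotent_quad {X : ℤ → Op} (h : ∀ i j, X i * X j + X j * X i = 0) (A : ℤ → ℤ → ℂ)
    (S : Finset ℤ) : IsNilpotent (quad X A S) := by
  have h' := fun i j => eq_neg_of_add_eq_zero_left (h i j)
  refine IsNilpotent.smul ?_ _
  rw [← Finset.sum_product']
  refine Commute.isNilpotent_sum (fun p _ => ?_) fun p q _ _ => ?_
  · exact IsNilpotent.smul ⟨2, sq_pair (sq_zero_of_anticomm (h _ _)) (h' _ _)⟩ _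
  · exact ((pair_commute (h _ _) (h _ _) (h _ _) (h _ _)).smul_left _).smul_right _

section

variable {X Y X' Y' : ℤ → Op} {v v' : Fock}

theorem lin_mem_subalgebra (K : Subalgebra ℂ (Op × Op)) (h : ∀ l, (X l, X' l) ∈ K) (a : ℤ → ℂ)
    (S : Finset ℤ) : (lin X a S, lin X' a S) ∈ K := by
  rw [lin, lin, prod_mk_sum]
  exact K.sum_mem fun i _ => K.smul_mem (h i) _

theorem quad_mem_subalgebra (K : Subalgebra ℂ (Op × Op)) (h : ∀ l, (X l, X' l) ∈ K)
    (A : ℤ → ℤ → ℂ) (S : Finset ℤ) : (quad X A S, quad X' A S) ∈ K := by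
  have : (∑ i ∈ S, ∑ j ∈ S, A i j • (X i * X j), ∑ i ∈ S, ∑ j ∈ S, A i j • (X' i * X' j)) ∈ K := by
    rw [prod_mk_sum]
    refine K.sum_mem fun i _ => ?_
    rw [prod_mk_sum]
    exact K.sum_mem fun j _ => K.smul_mem (K.mul_mem (h i) (h j)) _
  exact K.smul_mem this _

/-! ## The words `Ψ†_N e^{∑ t β} e^{½ ∑ A x x}` -/

/-- The coefficient of `t^d` in `Ψ†_N e^{∑_i t_i J_i} e^{½ ∑ A_{ij} x_i x_j}`, where `J_i` are the
currents of the family `X, Y` of fermions. -/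
def word (h : IsCharged X Y) (A : ℤ → ℤ → ℂ) (N : ℤ) (S : Finset ℤ) (d : ℤ →₀ ℕ) : Op :=
  PsiDag X Y N * evolCoeff (current h) d * IsNilpotent.exp (quad X A S)

variable (h : IsCharged X Y) (h' : IsCharged X' Y') (A : ℤ → ℤ → ℂ) (a : ℤ → ℂ) (N : ℤ)
  (S : Finset ℤ) (d : ℤ →₀ ℕ)

theorem word_mem_corrAlgebra (hv : IsVacuum X Y v) (hv' : IsVacuum X' Y' v') :
    (word h A N S d, word h' A N S d) ∈ corrAlgebra X Y X' Y' v v' := by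
  set K := corrAlgebra X Y X' Y' v v'
  have h1 := PsiDag_mem_corrAlgebra h h' hv hv' N
  have h2 := evolCoeff_mem_subalgebra K (current_mem_corrAlgebra h h' hv hv') d
  have h3 := exp_mem_subalgebra K (isNilpotent_quad h.XX A S) (isNilpotent_quad h'.XX A S)
    (quad_mem_subalgebra K (X_mem_corrAlgebra h h' hv hv') A S)
  exact K.mul_mem (K.mul_mem h1 h2) h3

theorem word_mul_lin_mem_corrAlgebra (hv : IsVacuum X Y v) (hv' : IsVacuum X' Y' v') :
    (word h A N S d * lin X a S, word h' A N S d * lin X' a S) ∈ corrAlgebra X Y X' Y' v v' :=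
  (corrAlgebra X Y X' Y' v v').mul_mem (word_mem_corrAlgebra h h' A N S d hv hv')
    (lin_mem_subalgebra _ (X_mem_corrAlgebra h h' hv hv') a S)

theorem bra0_word_vac_eq : bra0 (word h A N S d vac) = bra0 (word h' A N S d vac) := by
  have := bra0_mul_of_mem_corrAlgebra h h' (word_mem_corrAlgebra h h' A N S d h.isVacuum h'.isVacuum)
  simpa [bra0_vac] using this

theorem bra0_word_lin_vac_eq :
    bra0 (word h A N S d (lin X a S vac)) = bra0 (word h' A N S d (lin X' a S vac)) := by
  have := bra0_mul_of_mem_corrAlgebra h h'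
    (word_mul_lin_mem_corrAlgebra h h' A a N S d h.isVacuum h'.isVacuum)
  simpa [bra0_vac] using this

/-- The family is compared with itself, once on |0⟩ and once on `v`. With `v` generated by an
anticommuting family this becomes the factorization of expectation values. -/
theorem bra0_word_apply (hv : IsVacuum X Y v) :
    bra0 (word h A N S d v) = bra0 (word h A N S d vac) * bra0 v := by
  have := bra0_mul_of_mem_corrAlgebra h h (word_mem_corrAlgebra h h A N S d h.isVacuum hv)
  simpa [bra0_vac] using this.symm

theorem bra0_word_lin_apply (hv : IsVacuum X Y v) :
    bra0 (word h A N S d (lin X a S v)) = bra0 (word h A N S d (lin X a S vac)) * bra0 v := by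
  have := bra0_mul_of_mem_corrAlgebra h h
    (word_mul_lin_mem_corrAlgebra h h A a N S d h.isVacuum hv)
  simpa [bra0_vac] using this.symm

theorem word_neg : word h.neg A N S d = ((-1 : ℂ) ^ N.natAbs) • word h A N S d := by
  rw [word, word, PsiDag_neg, h.current_neg, quad_neg, smul_mul_assoc, smul_mul_assoc]

/-- The negated family has the same expectation value, yet the word changes sign, since only Ψ†_N is
odd in the fermions. -/
theorem bra0_word_of_odd (hN : Odd N) : bra0 (word h A N S d vac) = 0 := by
  have e := bra0_word_vac_eq h h.neg A N S d
  rw [word_neg h, (Int.natAbs_odd.2 hN).neg_one_pow, LinearMap.smul_apply, map_smul, smul_eq_mul] at e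
  linear_combination e / 2

/-- Here the single linear factor carries the sign under negation of the family. -/
theorem bra0_word_lin_of_even (hN : Even N) : bra0 (word h A N S d (lin X a S vac)) = 0 := by
  have e := bra0_word_lin_vac_eq h h.neg A a N S d
  rw [word_neg h, (Int.natAbs_even.2 hN).neg_one_pow, one_smul, lin_neg, LinearMap.neg_apply,
    map_neg, map_neg] at e
  linear_combination e / 2

/-- The currents and the quadratic exponential are even and commute with `T`; each of the |N|
fermions in Ψ†_N contributes a sign. -/
theorem anticomm_word {T : Op} (hX : ∀ l, T * X l + X l * T = 0)
    (hY : ∀ l, T * Y l + Y l * T = 0) :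
    T * word h A N S d = ((-1 : ℂ) ^ N.natAbs) • (word h A N S d * T) := by
  have h1 : T * evolCoeff (current h) d = evolCoeff (current h) d * T :=
    commute_evolCoeff (commute_current h hX hY) d
  have h2 : T * IsNilpotent.exp (quad X A S) = IsNilpotent.exp (quad X A S) * T :=
    commute_exp (isNilpotent_quad h.XX A S) (commute_quad hX A S)
  rw [word, ← mul_assoc, ← mul_assoc, anticomm_PsiDag hX hY, smul_mul_assoc, smul_mul_assoc,
    mul_assoc _ T, h1, ← mul_assoc, mul_assoc _ T, h2, ← mul_assoc]

/-- For `T` an annihilator of one family, this makes a state generated by the other family a vacuum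
of the first. -/
theorem apply_word_eq_zero {T : Op} (hX : ∀ l, T * X l + X l * T = 0)
    (hY : ∀ l, T * Y l + Y l * T = 0) (hv : T v = 0) : T (word h A N S d v) = 0 := by
  have := congrArg (fun W : Op => W v) (anticomm_word h A N S d hX hY)
  simp only [Module.End.mul_apply, LinearMap.smul_apply, hv, map_zero, smul_zero] at this
  exact this

theorem apply_lin_eq_zero {T : Op} (hX : ∀ l, T * X l + X l * T = 0) (hv : T v = 0) :
    T (lin X a S v) = 0 := by
  have := congrArg (fun W : Op => W v) (anticomm_lin hX a S)
  simpa [hv] using this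

end

/-! ## Elimination of `φ` -/

theorem sqrt_two_mul_self : ((Real.sqrt 2 : ℝ) : ℂ) * ((Real.sqrt 2 : ℝ) : ℂ) = 2 := by
  rw [← Complex.ofReal_mul, Real.mul_self_sqrt (by norm_num)]; norm_num

theorem phi_psiB (i : ℤ) : phi * psiB i + psiB i * phi = 0 := by
  rw [add_comm, psiB_phi]

theorem phi_psiDagB (i : ℤ) : phi * psiDagB i + psiDagB i * phi = 0 := by
  rw [add_comm, psiDagB, phi, anticomm_smul_add, psi0_psiC, psi0_psiDagC, psiDag0_psiC,
    psiDag0_psiDagC]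
  simp

theorem isVacuum_phi_vac : IsVacuum psiB psiDagB (phi vac) := by
  constructor
  · intro l hl
    have := congrArg (fun W : Op => W vac) (phi_psiB l)
    simpa [psiB_vac hl] using this
  · intro l hl
    have := congrArg (fun W : Op => W vac) (phi_psiDagB l)
    simpa [psiDagB_vac hl] using this

theorem bra0_phi_vac : bra0 (phi vac) = 0 := by
  simp [phi, psi0, psiDag0, annih_vac, bra0_create]

theorem quadB_eq (A : ℤ → ℤ → ℂ) (a : ℤ → ℂ) (S : Finset ℤ) :
    quadB A a S = quad psiB A S + ((Real.sqrt 2 : ℝ) : ℂ) • (lin psiB a S * phi) := by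
  simp only [quadB, quad, lin, Finset.sum_mul, smul_mul_assoc]

/-- The term with φ is even, commutes with the quadratic part and has square zero, so its
exponential stops after the linear term. -/
theorem exp_quadB (A : ℤ → ℤ → ℂ) (a : ℤ → ℂ) (S : Finset ℤ) :
    IsNilpotent.exp (quadB A a S) = IsNilpotent.exp (quad psiB A S) *
      (1 + ((Real.sqrt 2 : ℝ) : ℂ) • (lin psiB a S * phi)) := by
  have hX := lin_mul_lin psiB_psiB a S
  have hp : phi * lin psiB a S = -(lin psiB a S * phi) :=
    eq_neg_of_add_eq_zero_left (anticomm_lin phi_psiB a S)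
  have hsq : (((Real.sqrt 2 : ℝ) : ℂ) • (lin psiB a S * phi)) *
      (((Real.sqrt 2 : ℝ) : ℂ) • (lin psiB a S * phi)) = 0 := by
    rw [smul_mul_smul_comm, ← pow_two (lin psiB a S * phi), sq_pair hX hp, smul_zero]
  have hc : Commute (quad psiB A S) (((Real.sqrt 2 : ℝ) : ℂ) • (lin psiB a S * phi)) := by
    refine Commute.smul_right (Commute.mul_right ?_ ?_) _
    · refine (commute_quad (fun l => ?_) A S).symm
      rw [add_comm]
      exact anticomm_lin (fun k => psiB_psiB l k) a S
    · exact (commute_quad phi_psiB A S).symm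
  rw [quadB_eq, IsNilpotent.exp_add_of_commute hc (isNilpotent_quad psiB_psiB A S)
    ⟨2, by rw [pow_two, hsq]⟩, exp_of_sq_eq_zero hsq]

/-- The coefficients of the truncated B-type tau function, without `φ`. -/
theorem coeff_tauBTrunc (A : ℤ → ℤ → ℂ) (a : ℤ → ℂ) (N : ℤ) (S : Finset ℤ) (d : ℤ →₀ ℕ) :
    MvPowerSeries.coeff d (tauBTrunc A a N S) =
      if Even N then bra0 (word isCharged_psiB A N S d vac)
      else bra0 (word isCharged_psiB A N S d (lin psiB a S vac)) := by
  have h := isCharged_psiB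
  rw [tauBTrunc, coeff_evolve, exp_quadB, braB]
  split_ifs with hN
  · have e : (bra0 ∘ₗ PsiDag psiB psiDagB N) (evolCoeff beta d
        ((IsNilpotent.exp (quad psiB A S) *
          (1 + ((Real.sqrt 2 : ℝ) : ℂ) • (lin psiB a S * phi))) vac)) =
        bra0 (word h A N S d vac) +
          ((Real.sqrt 2 : ℝ) : ℂ) * bra0 (word h A N S d (lin psiB a S (phi vac))) := by
      simp [word, current_psiB]
    -- φ|0⟩ is a vacuum of the family ψ orthogonal to ⟨0|, so the term with φ drops out.
    rw [e, bra0_word_lin_apply h A a N S d isVacuum_phi_vac, bra0_phi_vac]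
    ring
  · have hN' := Int.natAbs_odd.2 (Int.not_even_iff_odd.1 hN)
    have e : (((Real.sqrt 2 : ℝ) : ℂ) • (bra0 ∘ₗ (phi * PsiDag psiB psiDagB N))) (evolCoeff beta d
        ((IsNilpotent.exp (quad psiB A S) *
          (1 + ((Real.sqrt 2 : ℝ) : ℂ) • (lin psiB a S * phi))) vac)) =
        ((Real.sqrt 2 : ℝ) : ℂ) * (bra0 ((phi * word h A N S d) vac) +
          ((Real.sqrt 2 : ℝ) : ℂ) * bra0 ((phi * word h A N S d) (lin psiB a S (phi vac)))) := by
      simp [word, current_psiB, mul_add]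
    have e2 : lin psiB a S (phi vac) = -phi (lin psiB a S vac) := by
      have := congrArg (fun W : Op => W vac) (anticomm_lin phi_psiB a S)
      exact eq_neg_of_add_eq_zero_right this
    have e3 : phi (phi (lin psiB a S vac)) = (2⁻¹ : ℂ) • lin psiB a S vac :=
      congrArg (fun W : Op => W (lin psiB a S vac)) phi_phi
    -- The φ of ⟨N| is moved through the odd word. Without a second φ it meets |0⟩ and the term
    -- vanishes; with one, φ² = ½ cancels the two factors √2, and the signs from the two moves
    -- cancel.
    rw [e, anticomm_word h A N S d phi_psiB phi_psiDagB, hN'.neg_one_pow, e2]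
    simp only [neg_smul, one_smul, LinearMap.neg_apply, Module.End.mul_apply, map_neg, e3, neg_neg]
    rw [bra0_word_apply h A N S d isVacuum_phi_vac, bra0_phi_vac, map_smul, map_smul, smul_eq_mul]
    linear_combination (bra0 (word h A N S d (lin psiB a S vac)) / 2) * sqrt_two_mul_self

/-! ## The Toda lattice side in terms of two commuting copies of the B-type fermions -/

theorem I_zpow_eq (N : ℤ) (hN : N < 0) : Complex.I ^ N = (-Complex.I) ^ N.natAbs := by
  rw [← Complex.inv_I, inv_pow, ← zpow_natCast, ← zpow_neg]
  congr 1
  omega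

theorem psiDagC_zero_mul_psiC_one (j : ℤ) :
    psiDagC 0 j * psiC 1 (-1 - j) = Complex.I • (psiDagB j * psiDagB' j) := by
  have h := isCharged_psiB.YY j j
  have h' := isCharged_psiB'.YY j j
  have e : psiDagB' j * psiDagB j = -(psiDagB j * psiDagB' j) :=
    eq_neg_of_add_eq_zero_left (psiDagB'_psiDagB j j)
  rw [psiDagC_zero_eq, psiC_one_eq, smul_mul_smul_comm, inv_sqrt_two_mul_self]
  simp only [add_mul, mul_add, smul_mul_assoc, mul_smul_comm, e, sq_zero_of_anticomm h,
    sq_zero_of_anticomm h']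
  match_scalars
  ring

theorem psiC_zero_mul_psiDagC_one (i j : ℤ) :
    psiC 0 i * psiDagC 1 (-1 - j) = (2⁻¹ : ℂ) • (psiB i * psiB j) + (2⁻¹ : ℂ) • (psiB' i * psiB' j) +
      (-Complex.I / 2) • (psiB i * psiB' j + psiB j * psiB' i) := by
  have e : psiB' i * psiB j = -(psiB j * psiB' i) := eq_neg_of_add_eq_zero_left (psiB'_psiB i j)
  rw [psiC_zero_eq, psiDagC_one_eq, smul_mul_smul_comm, inv_sqrt_two_mul_self]
  simp only [add_mul, mul_add, smul_mul_assoc, mul_smul_comm, e]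
  match_scalars
  · ring
  · ring
  · ring
  · linear_combination (-1 / 2 : ℂ) * Complex.I_sq

theorem psiC_zero_mul_psiDagC_one_self (j : ℤ) :
    psiC 0 j * psiDagC 1 (-1 - j) = (-Complex.I) • (psiB j * psiB' j) := by
  rw [psiC_zero_mul_psiDagC_one, sq_zero_of_anticomm (psiB_psiB j j),
    sq_zero_of_anticomm (isCharged_psiB'.XX j j)]
  module

/-- The factors of equal position are ψ^{†(1)}_j ψ^{(2)}_{-1-j} = iψ†_jψ'†_j for N > 0 and ψ^{(1)}_j
ψ^{†(2)}_{-1-j} = -iψ_jψ'_j for N < 0. In both cases |N| of them give i^N. -/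
theorem PsiDag_mul_PsiDag (N : ℤ) :
    PsiDag (psiC 0) (psiDagC 0) N * PsiDag (psiC 1) (psiDagC 1) (-N) =
      Complex.I ^ N • (PsiDag psiB psiDagB N * PsiDag psiB' psiDagB' N) := by
  simp only [PsiDag_natAbs, Int.natAbs_neg]
  rcases lt_trichotomy N 0 with hN | rfl | hN
  · rw [if_neg (not_le.2 hN), if_pos (by omega), if_neg (not_le.2 hN), if_neg (not_le.2 hN),
      I_zpow_eq N hN]
    refine prod_range_mul_prod_range (fun k => ?_) (fun k l => ?_) (fun k l => ?_) _
    · rw [← psiC_zero_mul_psiDagC_one_self]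
      congr 2
      ring
    · rw [psiC_psiDagC]; simp
    · rw [add_comm, psiB'_psiB]
  · simp
  · rw [if_pos hN.le, if_neg (by omega), if_pos hN.le, if_pos hN.le,
      show Complex.I ^ N = Complex.I ^ N.natAbs by
        rw [← zpow_natCast]; congr 1; omega]
    refine prod_range_mul_prod_range (fun k => ?_) (fun k l => ?_) (fun k l => ?_) _
    · exact psiDagC_zero_mul_psiC_one k
    · rw [add_comm, psiC_psiDagC]; simp
    · rw [add_comm, psiDagB'_psiDagB]

theorem lin_psiC_zero (a : ℤ → ℂ) (S : Finset ℤ) : lin (psiC 0) a S =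
    ((Real.sqrt 2 : ℝ) : ℂ)⁻¹ • (lin psiB a S + Complex.I • lin psiB' a S) := by
  simp only [lin, Finset.smul_sum, ← Finset.sum_add_distrib, psiC_zero_eq]
  exact Finset.sum_congr rfl fun i _ => by module

theorem lin_psiDagC_one (a : ℤ → ℂ) (S : Finset ℤ) : lin (fun j => psiDagC 1 (-1 - j)) a S =
    ((Real.sqrt 2 : ℝ) : ℂ)⁻¹ • (lin psiB a S + (-Complex.I) • lin psiB' a S) := by
  simp only [lin, Finset.smul_sum, ← Finset.sum_add_distrib, psiDagC_one_eq]
  exact Finset.sum_congr rfl fun i _ => by module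

theorem psiB'_lin (a : ℤ → ℂ) (S : Finset ℤ) (l : ℤ) :
    psiB' l * lin psiB a S + lin psiB a S * psiB' l = 0 :=
  anticomm_lin (fun k => psiB'_psiB l k) a S

theorem lin_psiB' (a : ℤ → ℂ) (S : Finset ℤ) (l : ℤ) :
    lin psiB a S * psiB' l + psiB' l * lin psiB a S = 0 := by
  rw [add_comm, psiB'_lin]

theorem lin_psiDagB' (a : ℤ → ℂ) (S : Finset ℤ) (l : ℤ) :
    lin psiB a S * psiDagB' l + psiDagB' l * lin psiB a S = 0 := by
  rw [add_comm]
  exact anticomm_lin (fun k => psiDagB'_psiB l k) a S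

theorem sum_mul_psiC_psiDagC (a : ℤ → ℂ) (S : Finset ℤ) :
    ∑ i ∈ S, ∑ j ∈ S, (a i * a j) • (psiC 0 i * psiDagC 1 (-1 - j)) =
      (-Complex.I) • (lin psiB a S * lin psiB' a S) := by
  have e : ∑ i ∈ S, ∑ j ∈ S, (a i * a j) • (psiC 0 i * psiDagC 1 (-1 - j)) =
      lin (psiC 0) a S * lin (fun j => psiDagC 1 (-1 - j)) a S := by
    simp only [lin, Finset.sum_mul_sum, smul_mul_smul_comm]
  have e' : lin psiB' a S * lin psiB a S = -(lin psiB a S * lin psiB' a S) :=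
    eq_neg_of_add_eq_zero_right (anticomm_lin (lin_psiB' a S) a S)
  rw [e, lin_psiC_zero, lin_psiDagC_one, smul_mul_smul_comm, inv_sqrt_two_mul_self]
  simp only [add_mul, mul_add, smul_mul_assoc, mul_smul_comm, e', lin_mul_lin psiB_psiB,
    lin_mul_lin isCharged_psiB'.XX]
  module

theorem sum_antisymm_eq_zero {A : ℤ → ℤ → ℂ} (hA : ∀ i j, A i j = -A j i) (S : Finset ℤ)
    (f : ℤ → ℤ → Op) : ∑ i ∈ S, ∑ j ∈ S, A i j • (f i j + f j i) = 0 := by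
  set x := ∑ i ∈ S, ∑ j ∈ S, A i j • (f i j + f j i) with hx
  have h : x + x = 0 := by
    nth_rw 2 [hx]
    rw [Finset.sum_comm, hx, ← Finset.sum_add_distrib]
    refine Finset.sum_eq_zero fun i _ => ?_
    rw [← Finset.sum_add_distrib]
    refine Finset.sum_eq_zero fun j _ => ?_
    rw [hA i j, add_comm (f j i), neg_smul, neg_add_cancel]
  rwa [← two_smul ℂ, smul_eq_zero_iff_right two_ne_zero] at h

/-- The mixed part of ψ^{(1)}_i ψ^{†(2)}_{-1-j} is symmetric in i, j and vanishes against A. Against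
a_i a_j only the mixed part survives, because a linear combination of anticommuting fermions squares
to zero. -/
theorem quadTL_eq {A : ℤ → ℤ → ℂ} (hA : ∀ i j, A i j = -A j i) (a : ℤ → ℂ) (S : Finset ℤ) :
    quadTL (fun i j => A i j - a i * a j) S = quad psiB A S + quad psiB' A S +
      Complex.I • (lin psiB a S * lin psiB' a S) := by
  have e : quadTL A S = quad psiB A S + quad psiB' A S +
      (-Complex.I / 2) • ∑ i ∈ S, ∑ j ∈ S, A i j • (psiB i * psiB' j + psiB j * psiB' i) := by
    simp only [quadTL, quad, psiC_zero_mul_psiDagC_one, Finset.smul_sum, ← Finset.sum_add_distrib]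
    exact Finset.sum_congr rfl fun i _ => Finset.sum_congr rfl fun j _ => by module
  rw [sum_antisymm_eq_zero hA S fun i j => psiB i * psiB' j, smul_zero, add_zero] at e
  rw [← e]
  simp only [quadTL, sub_smul, Finset.sum_sub_distrib]
  rw [sum_mul_psiC_psiDagC]
  module

theorem exp_quadTL {A : ℤ → ℤ → ℂ} (hA : ∀ i j, A i j = -A j i) (a : ℤ → ℂ) (S : Finset ℤ) :
    IsNilpotent.exp (quadTL (fun i j => A i j - a i * a j) S) =
      IsNilpotent.exp (quad psiB A S) * IsNilpotent.exp (quad psiB' A S) *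
        (1 + Complex.I • (lin psiB a S * lin psiB' a S)) := by
  have hB := psiB_psiB
  have hB' := isCharged_psiB'.XX
  have lB : ∀ l, lin psiB a S * psiB l + psiB l * lin psiB a S = 0 := fun l => by
    rw [add_comm]; exact anticomm_lin (hB l) a S
  have lB' : ∀ l, lin psiB' a S * psiB' l + psiB' l * lin psiB' a S = 0 := fun l => by
    rw [add_comm]; exact anticomm_lin (hB' l) a S
  have l'B : ∀ l, lin psiB' a S * psiB l + psiB l * lin psiB' a S = 0 := fun l => by
    rw [add_comm]; exact anticomm_lin (fun k => by rw [add_comm, psiB'_psiB]) a S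
  have hsq : (Complex.I • (lin psiB a S * lin psiB' a S)) *
      (Complex.I • (lin psiB a S * lin psiB' a S)) = 0 := by
    rw [smul_mul_smul_comm, ← pow_two (lin psiB a S * _), sq_pair (lin_mul_lin hB a S)
      (eq_neg_of_add_eq_zero_right (anticomm_lin (lin_psiB' a S) a S)), smul_zero]
  have hqq : Commute (quad psiB A S) (quad psiB' A S) :=
    quad_commute_of_commute (fun i j => (quad_commute_of_commute (fun k l =>
      pair_commute (psiB'_psiB _ _) (psiB'_psiB _ _) (psiB'_psiB _ _) (psiB'_psiB _ _)) A S).symm) A S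
  have hc : Commute (quad psiB A S + quad psiB' A S)
      (Complex.I • (lin psiB a S * lin psiB' a S)) :=
    Commute.smul_right (Commute.add_left
      ((commute_quad lB A S).symm.mul_right (commute_quad l'B A S).symm)
      ((commute_quad (lin_psiB' a S) A S).symm.mul_right (commute_quad lB' A S).symm)) _
  have n := isNilpotent_quad hB A S
  have n' := isNilpotent_quad hB' A S
  rw [quadTL_eq hA, IsNilpotent.exp_add_of_commute hc (hqq.isNilpotent_add n n')
    ⟨2, by rw [pow_two, hsq]⟩, exp_of_sq_eq_zero hsq, IsNilpotent.exp_add_of_commute hqq n n']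

/-- Only the even factors of the ψ-word have to pass factors of the ψ'-word, so no sign appears. -/
theorem word_mul_word (A : ℤ → ℤ → ℂ) (N : ℤ) (S : Finset ℤ) (d d' : ℤ →₀ ℕ) :
    PsiDag psiB psiDagB N * PsiDag psiB' psiDagB' N * (evolCoeff beta d * evolCoeff beta' d') *
      (IsNilpotent.exp (quad psiB A S) * IsNilpotent.exp (quad psiB' A S)) =
    word isCharged_psiB A N S d * word isCharged_psiB' A N S d' := by
  have hPd : ∀ {T : Op}, (∀ l, Commute T (psiB' l)) → (∀ l, Commute T (psiDagB' l)) →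
      Commute T (PsiDag psiB' psiDagB' N) := by
    intro T h1 h2
    rw [PsiDag_natAbs]
    split_ifs <;> refine Commute.list_prod_right _ _ fun x hx => ?_ <;>
      obtain ⟨k, -, rfl⟩ := List.mem_map.1 hx
    · exact h2 _
    · exact h1 _
  have c1 : Commute (evolCoeff beta d) (PsiDag psiB' psiDagB' N) :=
    hPd (fun l => (commute_evolCoeff (commute_current isCharged_psiB (psiB'_psiB l)
        (psiB'_psiDagB l)) d).symm)
      (fun l => (commute_evolCoeff (commute_current isCharged_psiB (psiDagB'_psiB l)
        (psiDagB'_psiDagB l)) d).symm)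
  have c2 : Commute (IsNilpotent.exp (quad psiB A S)) (PsiDag psiB' psiDagB' N) :=
    hPd (fun l => (commute_exp (isNilpotent_quad psiB_psiB A S)
        (commute_quad (psiB'_psiB l) A S)).symm)
      (fun l => (commute_exp (isNilpotent_quad psiB_psiB A S)
        (commute_quad (psiDagB'_psiB l) A S)).symm)
  have c3 : Commute (IsNilpotent.exp (quad psiB A S)) (evolCoeff beta' d') := by
    refine commute_evolCoeff (fun k => ?_) d'
    refine (commute_exp (isNilpotent_quad psiB_psiB A S) ?_).symm
    refine (quad_commute_of_commute (fun i j => ?_) A S).symm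
    exact Commute.mul_left
      (commute_current isCharged_psiB' (fun l => by rw [add_comm, psiB'_psiB])
        (fun l => by rw [add_comm, psiDagB'_psiB]) k)
      (commute_current isCharged_psiB' (fun l => by rw [add_comm, psiB'_psiB])
        (fun l => by rw [add_comm, psiDagB'_psiB]) k)
  simp only [word, current_psiB]
  calc _ = PsiDag psiB psiDagB N * (PsiDag psiB' psiDagB' N * evolCoeff beta d) *
        (evolCoeff beta' d' * IsNilpotent.exp (quad psiB A S)) *
          IsNilpotent.exp (quad psiB' A S) := by simp only [mul_assoc]
    _ = PsiDag psiB psiDagB N * evolCoeff beta d *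
        (PsiDag psiB' psiDagB' N * IsNilpotent.exp (quad psiB A S)) *
          evolCoeff beta' d' * IsNilpotent.exp (quad psiB' A S) := by
      rw [← c1.eq, ← c3.eq]; simp only [mul_assoc]
    _ = _ := by rw [← c2.eq]; simp only [mul_assoc]

/-- The ψ'-word applied to |0⟩ is a vacuum for the family ψ, so the ψ-word factors out. The
remaining ψ'-expectation equals the ψ-expectation. -/
theorem bra0_word_word (A : ℤ → ℤ → ℂ) (N : ℤ) (S : Finset ℤ) (d d' : ℤ →₀ ℕ) :
    bra0 (word isCharged_psiB A N S d (word isCharged_psiB' A N S d' vac)) =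
      bra0 (word isCharged_psiB A N S d vac) * bra0 (word isCharged_psiB A N S d' vac) := by
  rw [bra0_word_apply, bra0_word_vac_eq isCharged_psiB' isCharged_psiB]
  exact ⟨fun l hl => apply_word_eq_zero _ A N S d' (fun k => by rw [add_comm, psiB'_psiB])
      (fun k => by rw [add_comm, psiDagB'_psiB]) (psiB_vac hl),
    fun l hl => apply_word_eq_zero _ A N S d' (fun k => by rw [add_comm, psiB'_psiDagB])
      (fun k => by rw [add_comm, psiDagB'_psiDagB]) (psiDagB_vac hl)⟩

theorem bra0_word_lin_word_lin (A : ℤ → ℤ → ℂ) (a : ℤ → ℂ) (N : ℤ) (S : Finset ℤ)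
    (d d' : ℤ →₀ ℕ) :
    bra0 (word isCharged_psiB A N S d (lin psiB a S
        (word isCharged_psiB' A N S d' (lin psiB' a S vac)))) =
      bra0 (word isCharged_psiB A N S d (lin psiB a S vac)) *
        bra0 (word isCharged_psiB A N S d' (lin psiB a S vac)) := by
  rw [bra0_word_lin_apply, bra0_word_lin_vac_eq isCharged_psiB' isCharged_psiB]
  refine ⟨fun l hl => apply_word_eq_zero _ A N S d' (fun k => by rw [add_comm, psiB'_psiB])
      (fun k => by rw [add_comm, psiDagB'_psiB]) ?_,
    fun l hl => apply_word_eq_zero _ A N S d' (fun k => by rw [add_comm, psiB'_psiDagB])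
      (fun k => by rw [add_comm, psiDagB'_psiDagB]) ?_⟩
  · exact apply_lin_eq_zero _ _ (fun k => by rw [add_comm, psiB'_psiB]) (psiB_vac hl)
  · exact apply_lin_eq_zero _ _ (fun k => by rw [add_comm, psiB'_psiDagB]) (psiDagB_vac hl)

theorem coeff_tauTLTrunc {A : ℤ → ℤ → ℂ} (hA : ∀ i j, A i j = -A j i) (a : ℤ → ℂ) (N : ℤ)
    (S : Finset ℤ) (d : ℤ →₀ ℕ) :
    MvPowerSeries.coeff d (tauTLTrunc (fun i j => A i j - a i * a j) N S) =
      ((-1 : ℂ) ^ (N * (N + 1) / 2) * Complex.I ^ N) *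
        ∑ p ∈ Finset.HasAntidiagonal.antidiagonal d,
          (bra0 (word isCharged_psiB A N S p.1 vac) * bra0 (word isCharged_psiB A N S p.2 vac) +
            (Complex.I * (-1) ^ N.natAbs) *
              (bra0 (word isCharged_psiB A N S p.1 (lin psiB a S vac)) *
                bra0 (word isCharged_psiB A N S p.2 (lin psiB a S vac)))) := by
  have e : ∀ p : (ℤ →₀ ℕ) × (ℤ →₀ ℕ),
      PsiDag psiB psiDagB N * PsiDag psiB' psiDagB' N * (evolCoeff beta p.1 * evolCoeff beta' p.2) *
        (IsNilpotent.exp (quad psiB A S) * IsNilpotent.exp (quad psiB' A S) *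
        (1 + Complex.I • (lin psiB a S * lin psiB' a S))) =
      word isCharged_psiB A N S p.1 * word isCharged_psiB' A N S p.2 +
        (Complex.I * (-1) ^ N.natAbs) • (word isCharged_psiB A N S p.1 * (lin psiB a S *
          (word isCharged_psiB' A N S p.2 * lin psiB' a S))) := by
    intro p
    rw [← mul_assoc, word_mul_word, mul_add, mul_one, mul_smul_comm, mul_smul]
    congr 2
    -- X anticommutes with the ψ'-fermions, so passing it through the ψ'-word gives (-1)^N, which
    -- squares away against the sign in the statement.
    rw [← mul_assoc (lin psiB a S), anticomm_word _ A N S p.2 (lin_psiB' a S) (lin_psiDagB' a S),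
      smul_mul_assoc, mul_smul_comm, smul_smul, ← mul_pow, neg_one_mul, neg_neg, one_pow, one_smul]
    simp only [mul_assoc]
  rw [tauTLTrunc, MvPowerSeries.coeff_smul, coeff_evolve, braC, PsiDag_mul_PsiDag,
    exp_quadTL hA, funext alpha_sub_alpha, evolCoeff_add fun k l => (beta'_commute_beta l k).symm]
  rw [mul_assoc ((-1 : ℂ) ^ _)]
  congr 1
  calc _ = bra0 ((Complex.I ^ N • ∑ p ∈ Finset.HasAntidiagonal.antidiagonal d,
      PsiDag psiB psiDagB N * PsiDag psiB' psiDagB' N * (evolCoeff beta p.1 * evolCoeff beta' p.2) *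
        (IsNilpotent.exp (quad psiB A S) * IsNilpotent.exp (quad psiB' A S) *
        (1 + Complex.I • (lin psiB a S * lin psiB' a S)))) vac) := by
        rw [← Finset.sum_mul, ← Finset.mul_sum]
        rfl
    _ = _ := by
        simp only [e, LinearMap.smul_apply, LinearMap.sum_apply, LinearMap.add_apply, map_smul, map_sum,
          map_add, Module.End.mul_apply, smul_eq_mul, bra0_word_word, bra0_word_lin_word_lin]

/-! ### Signs for even and odd N, and the identity for finite truncations. -/

theorem sign_of_even {N : ℤ} (hN : Even N) :
    (-1 : ℂ) ^ N * ((-1) ^ (N * (N + 1) / 2) * Complex.I ^ N) = 1 := by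
  obtain ⟨m, rfl⟩ := hN
  have e : (m + m) * (m + m + 1) / 2 = (m + m + 1) * m := by
    rw [show (m + m) * (m + m + 1) = (m + m + 1) * m * 2 by ring]
    exact Int.mul_ediv_cancel _ two_ne_zero
  rw [e, zpow_mul, Even.neg_one_zpow ⟨m, rfl⟩, Odd.neg_one_zpow ⟨m, by ring⟩, one_mul, ← two_mul,
    zpow_mul, show Complex.I ^ (2 : ℤ) = -1 from Complex.I_sq, ← mul_zpow]
  simp

theorem sign_of_odd {N : ℤ} (hN : Odd N) :
    (-1 : ℂ) ^ N * ((-1) ^ (N * (N + 1) / 2) * Complex.I ^ N) * (Complex.I * -1) = 1 := by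
  obtain ⟨m, rfl⟩ := hN
  have e : (2 * m + 1) * (2 * m + 1 + 1) / 2 = (2 * m + 1) * (m + 1) := by
    rw [show (2 * m + 1) * (2 * m + 1 + 1) = (2 * m + 1) * (m + 1) * 2 by ring]
    exact Int.mul_ediv_cancel _ two_ne_zero
  have hI : Complex.I ^ (2 * m + 1) * Complex.I = (-1) ^ (m + 1) := by
    rw [← zpow_add_one₀ Complex.I_ne_zero, show 2 * m + 1 + 1 = 2 * (m + 1) by ring, zpow_mul]
    congr 1
    exact Complex.I_sq
  have h1 : (-1 : ℂ) ^ (m + 1) * (-1) ^ (m + 1) = 1 := by rw [← mul_zpow]; simp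
  rw [e, zpow_mul, Odd.neg_one_zpow ⟨m, rfl⟩]
  linear_combination ((-1 : ℂ) ^ (m + 1)) * hI + h1

/-- The identity of the truncated tau functions. -/
theorem tauBTrunc_sq {A : ℤ → ℤ → ℂ} (hA : ∀ i j, A i j = -A j i) (a : ℤ → ℂ) (N : ℤ)
    (S : Finset ℤ) : tauBTrunc A a N S ^ 2 =
      ((-1 : ℂ) ^ N) • tauTLTrunc (fun i j => A i j - a i * a j) N S := by
  classical
  ext1 d
  rw [MvPowerSeries.coeff_smul, coeff_tauTLTrunc hA, pow_two, MvPowerSeries.coeff_mul, ← mul_assoc]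
  simp only [coeff_tauBTrunc]
  split_ifs with hN
  · simp only [bra0_word_lin_of_even _ A a N S _ hN, mul_zero, add_zero]
    rw [sign_of_even hN, one_mul]
  · rw [Int.not_even_iff_odd] at hN
    simp only [bra0_word_of_odd _ A N S _ hN, (Int.natAbs_odd.2 hN).neg_one_pow, zero_mul, zero_add]
    rw [← Finset.mul_sum, ← mul_assoc, sign_of_odd hN, one_mul]

/-! ## Stabilization of the truncated tau functions -/

/-- This is [β_k, ψ_i] = ψ_{i-k}: only the term l = i - k of the current fails to commute with ψ_i,
and the constants of normal ordering play no role. -/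
theorem beta_psiB_apply (k i : ℤ) (v : Fock) :
    beta k (psiB i v) = psiB i (beta k v) + psiB (i - k) v := by
  have hc : ∀ l, psiB l * psiDagB (l + k) * psiB i =
      psiB i * (psiB l * psiDagB (l + k)) + if l = i - k then psiB l else 0 := by
    intro l
    have e1 : psiDagB (l + k) * psiB i = (if i = l + k then 1 else 0) - psiB i * psiDagB (l + k) := by
      rw [← psiB_psiDagB]; abel
    have e2 : psiB l * psiB i = -(psiB i * psiB l) := eq_neg_of_add_eq_zero_left (psiB_psiB l i)
    rw [mul_assoc, e1, mul_sub, ← mul_assoc, e2, neg_mul, sub_neg_eq_add, mul_assoc, add_comm]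
    congr 1
    by_cases h : l = i - k
    · rw [if_pos h, if_pos (by omega), mul_one]
    · rw [if_neg h, if_neg (by omega), mul_zero]
  have hl : ∀ l, normalProd (psiB l) (psiDagB (l + k)) (psiB i v) =
      psiB i (normalProd (psiB l) (psiDagB (l + k)) v) + if l = i - k then psiB l v else 0 := by
    intro l
    have := congrArg (fun W : Op => W v) (hc l)
    simp only [Module.End.mul_apply, LinearMap.add_apply] at this
    simp only [normalProd, LinearMap.sub_apply, Module.End.mul_apply, LinearMap.smul_apply,
      Module.End.one_apply, map_sub, map_smul, this]
    split_ifs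
    · abel
    · simp
  have hfin := locFin_normalProd psiB psiDagB k isCharged_psiB.X_vac isCharged_psiB.Y_vac
    isCharged_psiB.XY isCharged_psiB.X_create isCharged_psiB.Y_create v
  rw [beta, locFinSum_apply, locFinSum_apply, finsum_congr hl, finsum_add_distrib]
  · congr 1
    · exact ((psiB i : Fock →+ Fock).map_finsum hfin).symm
    · rw [finsum_eq_single _ (i - k) (fun l hl => if_neg hl), if_pos rfl]
  · refine hfin.subset fun l hl h0 => hl ?_
    simp only [h0, map_zero]
  · refine (Set.finite_singleton (i - k)).subset fun l hl => ?_
    by_contra h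
    exact hl (if_neg h)

/-- `w` vanishes on the image of `ψ_i` for all large `i`: `⟨w|ψ_i = 0` for `i ≥ n`. -/
def KillsFrom (w : Fock →ₗ[ℂ] ℂ) (n : ℤ) : Prop := ∀ i, n ≤ i → ∀ v, w (psiB i v) = 0

/-- The operators `W` such that `⟨w|W` kills all `ψ_i` with `i` large whenever `⟨w|` does, with a
bound that depends only on the one for `⟨w|`. -/
def boundedShift : Subalgebra ℂ Op where
  carrier := {W | ∀ n, ∃ m, ∀ w, KillsFrom w n → KillsFrom (w ∘ₗ W) m}
  mul_mem' {W W'} h h' n := by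
    obtain ⟨m, hm⟩ := h n
    obtain ⟨l, hl⟩ := h' m
    exact ⟨l, fun w hw => hl _ (hm w hw)⟩
  add_mem' {W W'} h h' n := by
    obtain ⟨m, hm⟩ := h n
    obtain ⟨l, hl⟩ := h' n
    refine ⟨max m l, fun w hw i hi v => ?_⟩
    have h1 := hm w hw i ((le_max_left _ _).trans hi) v
    have h2 := hl w hw i ((le_max_right _ _).trans hi) v
    simp only [LinearMap.comp_apply] at h1 h2
    simp [h1, h2]
  algebraMap_mem' r n := ⟨n, fun w hw i hi v => by
    have := hw i hi v
    change w (r • psiB i v) = 0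
    rw [map_smul, this, smul_zero]⟩

theorem psiB_mem_boundedShift (l : ℤ) : psiB l ∈ boundedShift := fun n =>
  ⟨n, fun w hw i hi v => by
    have := congrArg (fun W : Op => W v) (psiB_psiB l i)
    have e : psiB l (psiB i v) = -psiB i (psiB l v) := eq_neg_of_add_eq_zero_left this
    rw [LinearMap.comp_apply, e, map_neg, hw i hi, neg_zero]⟩

theorem psiDagB_mem_boundedShift (l : ℤ) : psiDagB l ∈ boundedShift := fun n =>
  -- The bound l + 1 excludes i = l, the only index for which ψ†_l and ψ_i do not anticommute to
  -- zero.
  ⟨max n (l + 1), fun w hw i hi v => by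
    have hi' := max_le_iff.1 hi
    have h := psiB_psiDagB i l
    rw [if_neg (by omega)] at h
    have := congrArg (fun W : Op => W v) h
    have e : psiDagB l (psiB i v) = -psiB i (psiDagB l v) := eq_neg_of_add_eq_zero_right this
    rw [LinearMap.comp_apply, e, map_neg, hw i hi'.1, neg_zero]⟩

theorem beta_mem_boundedShift (k : ℤ) : beta k ∈ boundedShift := fun n =>
  -- The commutator produces ψ_{i-k}, which is killed once i - k ≥ n.
  ⟨max n (n + k), fun w hw i hi v => by
    have hi' := max_le_iff.1 hi
    rw [LinearMap.comp_apply, beta_psiB_apply, map_add, hw i hi'.1, hw (i - k) (by omega), add_zero]⟩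

theorem evolCoeff_beta_mem_boundedShift (d : ℤ →₀ ℕ) : evolCoeff beta d ∈ boundedShift :=
  (evolCoeff_mem_subalgebra (boundedShift.prod ⊤) (B := beta) (B' := beta)
    (fun k => ⟨beta_mem_boundedShift k, trivial⟩) d).1

theorem PsiDag_mem_boundedShift (N : ℤ) : PsiDag psiB psiDagB N ∈ boundedShift := by
  rw [PsiDag_natAbs]
  split_ifs <;> refine boundedShift.list_prod_mem fun x hx => ?_ <;>
    obtain ⟨k, -, rfl⟩ := List.mem_map.1 hx
  · exact psiDagB_mem_boundedShift _
  · exact psiB_mem_boundedShift _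

theorem exists_killsFrom (N : ℤ) (d : ℤ →₀ ℕ) :
    ∃ m, KillsFrom (bra0 ∘ₗ (PsiDag psiB psiDagB N * evolCoeff beta d)) m := by
  obtain ⟨m, hm⟩ := boundedShift.mul_mem (PsiDag_mem_boundedShift N)
    (evolCoeff_beta_mem_boundedShift d) 0
  exact ⟨m, hm bra0 isCharged_psiB.bra_X⟩

/-! ### Effect of adding one index to the truncation set. -/

section

variable {A : ℤ → ℤ → ℂ} (a : ℤ → ℂ) {i : ℤ} {S : Finset ℤ}

theorem lin_insert (hi : i ∉ S) : lin psiB a (insert i S) = a i • psiB i + lin psiB a S := by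
  rw [lin, Finset.sum_insert hi, lin]

/-- The row and the column of the new index contribute equally, by antisymmetry of A and of the
product ψ_jψ_i, which cancels the factor ½. -/
theorem quad_insert (hA : ∀ i j, A i j = -A j i) (hi : i ∉ S) :
    quad psiB A (insert i S) = quad psiB A S + psiB i * lin psiB (A i) S := by
  have h1 : ∑ j ∈ S, A j i • (psiB j * psiB i) = psiB i * lin psiB (A i) S := by
    rw [lin, Finset.mul_sum]
    refine Finset.sum_congr rfl fun j _ => ?_
    rw [mul_smul_comm, eq_neg_of_add_eq_zero_left (psiB_psiB j i), hA j i, smul_neg, neg_smul,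
      neg_neg]
  have h2 : ∑ j ∈ S, A i j • (psiB i * psiB j) = psiB i * lin psiB (A i) S := by
    rw [lin, Finset.mul_sum]
    exact Finset.sum_congr rfl fun j _ => (mul_smul_comm _ _ _).symm
  have h3 : psiB i * psiB i = 0 := sq_zero_of_anticomm (psiB_psiB i i)
  simp only [quad, Finset.sum_insert hi, Finset.sum_add_distrib, h1, h2, h3]
  module

theorem exp_quad_insert (hA : ∀ i j, A i j = -A j i) (hi : i ∉ S) :
    IsNilpotent.exp (quad psiB A (insert i S)) =
      IsNilpotent.exp (quad psiB A S) * (1 + psiB i * lin psiB (A i) S) := by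
  have hl : ∀ l, psiB l * lin psiB (A i) S + lin psiB (A i) S * psiB l = 0 := fun l =>
    anticomm_lin (fun k => psiB_psiB l k) _ S
  have hsq : (psiB i * lin psiB (A i) S) ^ 2 = 0 :=
    sq_pair (sq_zero_of_anticomm (psiB_psiB i i)) (eq_neg_of_add_eq_zero_right (hl i))
  have hc : Commute (quad psiB A S) (psiB i * lin psiB (A i) S) :=
    ((commute_quad (psiB_psiB i) A S).symm.mul_right
      (commute_quad (fun l => by rw [add_comm, hl]) A S).symm)
  rw [quad_insert hA hi, IsNilpotent.exp_add_of_commute hc (isNilpotent_quad psiB_psiB A S) ⟨2, hsq⟩,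
    exp_of_sq_eq_zero (q := psiB i * lin psiB (A i) S) (by rw [← pow_two, hsq])]

theorem exp_quad_insert_apply_of_neg (hA : ∀ i j, A i j = -A j i) (hi : i ∉ S) {v : Fock}
    (hv : psiB i v = 0) : IsNilpotent.exp (quad psiB A (insert i S)) v =
      IsNilpotent.exp (quad psiB A S) v := by
  have e : psiB i (lin psiB (A i) S v) + lin psiB (A i) S (psiB i v) = 0 :=
    congrArg (fun W : Op => W v) (anticomm_lin (fun k => psiB_psiB i k) (A i) S)
  rw [hv, map_zero, add_zero] at e
  simp [exp_quad_insert hA hi, e]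

/-- ψ_i commutes with the quadratic exponential and can be moved left to meet `w`. -/
theorem apply_exp_quad_psiB {w : Fock →ₗ[ℂ] ℂ} (hw : ∀ v, w (psiB i v) = 0) (v : Fock) :
    w (IsNilpotent.exp (quad psiB A S) (psiB i v)) = 0 := by
  have e : psiB i (IsNilpotent.exp (quad psiB A S) v) = IsNilpotent.exp (quad psiB A S) (psiB i v) :=
    congrArg (fun W : Op => W v)
      (commute_exp (isNilpotent_quad psiB_psiB A S) (commute_quad (psiB_psiB i) A S))
  rw [← e, hw]

theorem apply_exp_quad_insert {w : Fock →ₗ[ℂ] ℂ} (hA : ∀ i j, A i j = -A j i) (hi : i ∉ S)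
    (hw : ∀ v, w (psiB i v) = 0) (v : Fock) :
    w (IsNilpotent.exp (quad psiB A (insert i S)) v) = w (IsNilpotent.exp (quad psiB A S) v) := by
  simp [exp_quad_insert hA hi, apply_exp_quad_psiB hw]

theorem apply_exp_quad_insert_vac {w : Fock →ₗ[ℂ] ℂ} (hA : ∀ i j, A i j = -A j i) (hi : i ∉ S)
    (h : i < 0 ∨ ∀ v, w (psiB i v) = 0) :
    w (IsNilpotent.exp (quad psiB A (insert i S)) vac) =
      w (IsNilpotent.exp (quad psiB A S) vac) := by
  rcases h with h | h
  · rw [exp_quad_insert_apply_of_neg hA hi (psiB_vac h)]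
  · exact apply_exp_quad_insert hA hi h _

theorem apply_exp_quad_insert_lin_vac {w : Fock →ₗ[ℂ] ℂ} (hA : ∀ i j, A i j = -A j i) (hi : i ∉ S)
    (h : i < 0 ∨ ∀ v, w (psiB i v) = 0) :
    w (IsNilpotent.exp (quad psiB A (insert i S)) (lin psiB a (insert i S) vac)) =
      w (IsNilpotent.exp (quad psiB A S) (lin psiB a S vac)) := by
  rcases h with h | h
  · have e : lin psiB a (insert i S) vac = lin psiB a S vac := by
      simp [lin_insert a hi, psiB_vac h]
    rw [e, exp_quad_insert_apply_of_neg hA hi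
      (apply_lin_eq_zero a S (psiB_psiB i) (psiB_vac h))]
  · rw [apply_exp_quad_insert hA hi h, lin_insert a hi]
    simp [apply_exp_quad_psiB h]

end

/-! ### Eventual constancy of the coefficients and passage to the limit. -/

theorem eventually_const_of_insert {f : Finset ℤ → ℂ} {m : ℤ}
    (hf : ∀ (S : Finset ℤ) (i : ℤ), i ∉ S → (i < 0 ∨ m ≤ i) → f (insert i S) = f S) :
    ∃ c, ∀ᶠ S : Finset ℤ in Filter.atTop, f S = c := by
  refine ⟨f (Finset.Ico 0 m), Filter.eventually_atTop.2 ⟨Finset.Ico 0 m, fun S hS => ?_⟩⟩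
  -- Every set containing [0, m) arises from it by inserting indices that leave `f` unchanged.
  have key : ∀ U : Finset ℤ, (∀ i ∈ U, i < 0 ∨ m ≤ i) →
      f (U ∪ Finset.Ico 0 m) = f (Finset.Ico 0 m) := by
    intro U
    induction U using Finset.induction_on with
    | empty => intro _; rw [Finset.empty_union]
    | insert i U hi ih =>
      intro h
      have hi' := h i (Finset.mem_insert_self _ _)
      rw [Finset.insert_union, hf _ i _ hi', ih fun j hj => h j (Finset.mem_insert_of_mem hj)]
      rw [Finset.mem_union, Finset.mem_Ico]
      rintro (h1 | h1)
      · exact hi h1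
      · omega
  have := key (S \ Finset.Ico 0 m) fun i hi => by
    rw [Finset.mem_sdiff, Finset.mem_Ico] at hi
    omega
  rwa [Finset.sdiff_union_of_subset hS] at this

theorem eventually_coeff_tauBTrunc {A : ℤ → ℤ → ℂ} (hA : ∀ i j, A i j = -A j i) (a : ℤ → ℂ) (N : ℤ)
    (d : ℤ →₀ ℕ) :
    ∃ c, ∀ᶠ S : Finset ℤ in Filter.atTop, MvPowerSeries.coeff d (tauBTrunc A a N S) = c := by
  obtain ⟨m, hm⟩ := exists_killsFrom N d
  refine eventually_const_of_insert (m := m) fun S i hi h => ?_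
  have h' := h.imp_right fun h => hm i h
  rw [coeff_tauBTrunc, coeff_tauBTrunc]
  split_ifs
  · exact apply_exp_quad_insert_vac hA hi h'
  · exact apply_exp_quad_insert_lin_vac a hA hi h'

theorem eventually_eq_limUnder {f : Finset ℤ → ℂ} {c : ℂ}
    (h : ∀ᶠ S : Finset ℤ in Filter.atTop, f S = c) :
    ∀ᶠ S : Finset ℤ in Filter.atTop, f S = Filter.limUnder Filter.atTop f := by
  have e : Filter.limUnder Filter.atTop f = c :=
    ((tendsto_const_nhds (x := c)).congr' (h.mono fun _ hS => hS.symm)).limUnder_eq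
  rwa [e]

theorem eventually_coeff_tauB {A : ℤ → ℤ → ℂ} (hA : ∀ i j, A i j = -A j i) (a : ℤ → ℂ) (N : ℤ)
    (d : ℤ →₀ ℕ) : ∀ᶠ S : Finset ℤ in Filter.atTop,
      MvPowerSeries.coeff d (tauBTrunc A a N S) = MvPowerSeries.coeff d (tauB A a N) := by
  obtain ⟨c, hc⟩ := eventually_coeff_tauBTrunc hA a N d
  exact eventually_eq_limUnder hc

theorem eventually_coeff_tauBTrunc_sq {A : ℤ → ℤ → ℂ} (hA : ∀ i j, A i j = -A j i) (a : ℤ → ℂ)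
    (N : ℤ) (d : ℤ →₀ ℕ) : ∀ᶠ S : Finset ℤ in Filter.atTop,
      MvPowerSeries.coeff d (tauBTrunc A a N S ^ 2) = MvPowerSeries.coeff d (tauB A a N ^ 2) := by
  classical
  simp only [pow_two, MvPowerSeries.coeff_mul]
  have h : ∀ᶠ S : Finset ℤ in Filter.atTop, ∀ p ∈ Finset.HasAntidiagonal.antidiagonal d,
      MvPowerSeries.coeff p.1 (tauBTrunc A a N S) = MvPowerSeries.coeff p.1 (tauB A a N) ∧
      MvPowerSeries.coeff p.2 (tauBTrunc A a N S) = MvPowerSeries.coeff p.2 (tauB A a N) :=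
    (Filter.eventually_all_finset _).2 fun p _ =>
      (eventually_coeff_tauB hA a N p.1).and (eventually_coeff_tauB hA a N p.2)
  filter_upwards [h] with S hS
  exact Finset.sum_congr rfl fun p hp => by rw [(hS p hp).1, (hS p hp).2]

theorem coeff_tauTLTrunc_eq {A : ℤ → ℤ → ℂ} (hA : ∀ i j, A i j = -A j i) (a : ℤ → ℂ) (N : ℤ)
    (S : Finset ℤ) (d : ℤ →₀ ℕ) :
    MvPowerSeries.coeff d (tauTLTrunc (fun i j => A i j - a i * a j) N S) =
      (-1) ^ N * MvPowerSeries.coeff d (tauBTrunc A a N S ^ 2) := by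
  have h : (-1 : ℂ) ^ N * (-1) ^ N = 1 := by rw [← mul_zpow]; simp
  rw [tauBTrunc_sq hA, MvPowerSeries.coeff_smul, ← mul_assoc, h, one_mul]

theorem eventually_coeff_tauTL {A : ℤ → ℤ → ℂ} (hA : ∀ i j, A i j = -A j i) (a : ℤ → ℂ) (N : ℤ)
    (d : ℤ →₀ ℕ) : ∀ᶠ S : Finset ℤ in Filter.atTop,
      MvPowerSeries.coeff d (tauTLTrunc (fun i j => A i j - a i * a j) N S) =
        MvPowerSeries.coeff d (tauTL (fun i j => A i j - a i * a j) N) := by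
  refine eventually_eq_limUnder (c := (-1) ^ N * MvPowerSeries.coeff d (tauB A a N ^ 2)) ?_
  -- No separate stability argument is needed: the truncated identity expresses the Toda coefficient
  -- through the stable square.
  filter_upwards [eventually_coeff_tauBTrunc_sq hA a N d] with S hS
  rw [coeff_tauTLTrunc_eq hA, hS]

end Fermi
end

theorem mainTheorem4 (A : ℤ → ℤ → ℂ) (a : ℤ → ℂ) (hA : ∀ i j, A i j = -A j i) (N : ℤ) :
    (∀ d : ℤ →₀ ℕ, ∀ᶠ S : Finset ℤ in Filter.atTop,
      MvPowerSeries.coeff d (Fermi.tauBTrunc A a N S) =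
        MvPowerSeries.coeff d (Fermi.tauB A a N)) ∧
    (∀ d : ℤ →₀ ℕ, ∀ᶠ S : Finset ℤ in Filter.atTop,
      MvPowerSeries.coeff d (Fermi.tauTLTrunc (fun i j => A i j - a i * a j) N S) =
        MvPowerSeries.coeff d (Fermi.tauTL (fun i j => A i j - a i * a j) N)) ∧
    (Fermi.tauB A a N) ^ 2 =
      ((-1 : ℂ) ^ N) • Fermi.tauTL (fun i j => A i j - a i * a j) N := by
  refine ⟨Fermi.eventually_coeff_tauB hA a N, Fermi.eventually_coeff_tauTL hA a N, ?_⟩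
  ext1 d
  -- One finite set on which both coefficients have reached their limits reduces the claim to the
  -- truncated identity.
  obtain ⟨S, h₁, h₂⟩ := ((Fermi.eventually_coeff_tauBTrunc_sq hA a N d).and
    (Fermi.eventually_coeff_tauTL hA a N d)).exists
  rw [← h₁, Fermi.tauBTrunc_sq hA, MvPowerSeries.coeff_smul, MvPowerSeries.coeff_smul, h₂]
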